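/- Let $k$ be a field and let $\Pi A_2$ be the preprojective algebra of the $A_2$ quiver: it has the $k$-basis $(1),(2),(12),(21)$, where $(1),(2)$ are orthogonal idempotents with sum $1$, $(12)$ and $(21)$ are arrows $1\to2$ and $2\to1$, and all products of two arrows vanish. Let $S_1,S_2$ be its simple modules and $P_1,P_2$ their projective covers, and let $Q_i=[\cdots\to P_i\to P_{i+1}\to P_i]$ (indices mod $2$, degrees $\le 0$, differentials given by the arrows) be the periodic projective resolution of $S_i$. Let $\mathcal E$ be the dg category with the four objects $S_1,S_2,P_1,P_2$ and the morphism complexes $\mathrm{Hom}^*$ between the complexes $Q_1,Q_2,P_1,P_2$. Its cohomology is $\mathrm{Ext}^*$ of the four modules. A contraction of $\mathcal E$ onto its cohomology consists of maps $i$ (a choice of cocycle representatives) and $p$ of degree $0$ and a map $H$ of degree $-1$, for each pair of objects, with $pd=0$, $pi=1$, $1-ip=dH+Hd$, $H^2=0$ and $Hi=0$. It defines $A_\infty$-operations $m_d=\sum_T m_d^T$ on $\mathrm{Ext}^*$ (with $m_1=0$), where $T$ runs over the planar rooted binary trees with $d$ leaves and $m_d^T$ is obtained by labelling leaves by $i$,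 branch points by $(g,f)\mapsto(-1)^{|f|}g\circ f$, internal edges by $f\mapsto(-1)^{|f|}H(f)$ and the root by $p$. Let $\Pi$ be the resulting category with objects $S_1,S_2,P_1,P_2$, and let $\alpha\in\mathrm{Ext}^1(S_2,S_1)$, $\beta\in\mathrm{Ext}^1(S_1,S_2)$ be the classes of the chain maps $Q_2\to Q_1[1]$ and $Q_1\to Q_2[1]$ that are $(-1)^m$ times the identity into each degree $m\le0$. Contractions exist, and for every contraction the following hold. 1. $\Pi$ and its full subcategory $\pi$ on the objects $S_1,S_2$ are strictly unital $A_\infty$-categories, and $\pi$ is generated by $\alpha$ and $\beta$ (under $m_2$, linear combinations, and starting from the identities). 2. $\pi$ is formal: $m_1^\pi=0$ and $m_d^\pi=0$ for all $d>2$. 3. The inclusion $\iota:\pi\hookrightarrow\Pi$, with $\iota(S_i)=S_i$, $\iota^1(f)=f$ for all morphisms $f$, and $\iota^d=0$ for $d\ge2$, is a (strict) $A_\infty$-functor. It is the only $A_\infty$-functor that is $S_i\mapsto S_i$ on objects with $\iota^1(\alpha)=\alpha$, $\iota^1(\beta)=\beta$ and $\iota^d=0$ for $d\ge2$. -/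

import Mathlib

open CategoryTheory DirectSum

universe u v w w'

noncomputable section

/-! ### Composable sequences and planar binary trees -/

/-- Composable sequences `(f_d, …, f_1)` of elements of a family `T X Y`. In `cons f p` the
element `f` is `f_1`, the one that is applied first, and `p` is `(f_d, …, f_2)`. -/
inductive CSeq {Obj : Type v} (T : Obj → Obj → Type w) : Obj → Obj → Type (max v w)
  | nil (X : Obj) : CSeq T X X
  | cons {X Y Z : Obj} (f : T X Y) (p : CSeq T Y Z) : CSeq T X Z

namespace CSeq

variable {Obj : Type v} {T : Obj → Obj → Type w}

/-- The sequence with the single entry `f`. -/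
def single {X Y : Obj} (f : T X Y) : CSeq T X Y := cons f (nil Y)

/-- The sequence `(g, f)` with two entries; `f` is applied first. -/
def pair {X Y Z : Obj} (g : T Y Z) (f : T X Y) : CSeq T X Z := cons f (single g)

/-- The number of entries. -/
def length {X Y : Obj} : CSeq T X Y → ℕ
  | nil _ => 0
  | cons _ p => p.length + 1

/-- Concatenation; the entries of the first argument are applied first. -/
def append {X Y Z : Obj} : CSeq T X Y → CSeq T Y Z → CSeq T X Z
  | nil _, q => q
  | cons f p, q => cons f (p.append q)

/-- Apply a map on objects and a map on entries to a sequence. -/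
def map {Obj' : Type w'} {T' : Obj' → Obj' → Type w} (F : Obj → Obj')
    (φ : ∀ {X Y : Obj}, T X Y → T' (F X) (F Y)) {X Y : Obj} : CSeq T X Y → CSeq T' (F X) (F Y)
  | nil X => nil (F X)
  | cons f p => cons (φ f) (p.map F φ)

/-- All ways of cutting a sequence into two consecutive, possibly empty, pieces; the first piece
is the one that is applied first. -/
def cuts {X Z : Obj} : CSeq T X Z → List (Σ Y : Obj, CSeq T X Y × CSeq T Y Z)
  | nil X => [⟨X, nil X, nil X⟩]
  | cons (X := X) f p =>
      ⟨X, nil X, cons f p⟩ :: p.cuts.map (fun c => ⟨c.1, cons f c.2.1, c.2.2⟩)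

/-- All ways of cutting a sequence into two consecutive pieces, the first one not empty. -/
def properCuts {X Z : Obj} : CSeq T X Z → List (Σ Y : Obj, CSeq T X Y × CSeq T Y Z)
  | nil _ => []
  | cons f p => p.cuts.map (fun c => ⟨c.1, cons f c.2.1, c.2.2⟩)

end CSeq

/-- Planar rooted binary trees whose leaves are labelled by composable elements. In `node l r` the
labels of `l` are applied before those of `r`. -/
inductive BTree {Obj : Type v} (T : Obj → Obj → Type w) : Obj → Obj → Type (max v w)
  | leaf {X Y : Obj} (f : T X Y) : BTree T X Y
  | node {X Y Z : Obj} (l : BTree T X Y) (r : BTree T Y Z) : BTree T X Z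

namespace CSeq

variable {Obj : Type v} {T : Obj → Obj → Type w}

/-- The one-leaf tree on a sequence with exactly one entry. -/
def leafTree {X Y : Obj} : CSeq T X Y → List (BTree T X Y)
  | nil _ => []
  | cons f (nil _) => [BTree.leaf f]
  | cons _ (cons _ _) => []

/-- The planar binary trees of height less than `n` whose leaves spell a given sequence. -/
def treesAux : ℕ → ∀ {X Y : Obj}, CSeq T X Y → List (BTree T X Y)
  | 0, _, _, _ => []
  | n + 1, _, _, p => p.leafTree ++ p.cuts.flatMap (fun c =>
      (treesAux n c.2.1).flatMap (fun l => (treesAux n c.2.2).map (fun r => BTree.node l r)))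

/-- All planar binary trees whose leaves spell the sequence `p`, each listed once. (A tree with `d`
leaves has height less than `d`.) -/
def trees {X Y : Obj} (p : CSeq T X Y) : List (BTree T X Y) := treesAux p.length p

end CSeq

/-! ### `A_∞`-categories and `A_∞`-functors -/

/-- The data of a (unital) `A_∞`-category: objects, `ℤ`-graded morphism modules, the operations
`m_d` (evaluated on composable sequences of `d` not necessarily homogeneous morphisms), and a
degree zero endomorphism of each object. The axioms are in `AInfData.IsAInfCategory`. -/
structure AInfData (k : Type u) [CommRing k] where
  Obj : Type v
  Hom : Obj → Obj → ℤ → Type w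
  [addCommGroup : ∀ X Y n, AddCommGroup (Hom X Y n)]
  [module : ∀ X Y n, Module k (Hom X Y n)]
  m : ∀ {X Y : Obj}, CSeq (fun X Y => ⨁ n, Hom X Y n) X Y → ⨁ n, Hom X Y n
  one : ∀ X : Obj, Hom X X 0

attribute [instance] AInfData.addCommGroup AInfData.module

/-- The degree `n` elements of a graded module. -/
def homogeneous (k : Type u) [CommRing k] (M : ℤ → Type w) [∀ n, AddCommGroup (M n)]
    [∀ n, Module k (M n)] (n : ℤ) : Submodule k (⨁ n, M n) :=
  LinearMap.range (DirectSum.lof k ℤ M n)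

/-- The linear map that multiplies a homogeneous element `f` by `(-1) ^ |f|`. -/
def signMap (k : Type u) [CommRing k] (M : ℤ → Type w) [∀ n, AddCommGroup (M n)]
    [∀ n, Module k (M n)] : (⨁ n, M n) →ₗ[k] ⨁ n, M n :=
  DirectSum.toModule k ℤ _ (fun n => (n.negOnePow : ℤ) • DirectSum.lof k ℤ M n)

namespace AInfData

variable {k : Type u} [CommRing k]

/-- The total morphism module `Hom(X,Y) = ⨁ n, Hom^n(X,Y)`. -/
abbrev Tot (C : AInfData.{u, v, w} k) (X Y : C.Obj) : Type w := ⨁ n, C.Hom X Y n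

/-- The identity as an element of the total morphism module. -/
def unit (C : AInfData.{u, v, w} k) (X : C.Obj) : C.Tot X X :=
  DirectSum.lof k ℤ (C.Hom X X) 0 (C.one X)

/-- Multiply each entry `f` of a sequence by `(-1) ^ (|f| - 1)`. On a sequence `(f_n, …, f_1)` of
homogeneous entries this is multiplication by the sign `(-1) ^ (|f_n| + ⋯ + |f_1| - n)`. -/
def twist (C : AInfData.{u, v, w} k) {X Y : C.Obj} (p : CSeq C.Tot X Y) : CSeq C.Tot X Y :=
  p.map id (fun {X Y} f => -signMap k (C.Hom X Y) f)

/-- `HomogSeq C p s`: all entries of `p` are homogeneous and their degrees add up to `s`. -/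
inductive HomogSeq (C : AInfData.{u, v, w} k) : ∀ {X Y : C.Obj}, CSeq C.Tot X Y → ℤ → Prop
  | nil (X : C.Obj) : HomogSeq C (CSeq.nil X) 0
  | cons {X Y Z : C.Obj} {f : C.Tot X Y} {p : CSeq C.Tot Y Z} {a s : ℤ}
      (hf : f ∈ homogeneous k (C.Hom X Y) a) (hp : HomogSeq C p s) :
      HomogSeq C (CSeq.cons f p) (a + s)

/-- A function on composable sequences is linear in each entry. -/
structure IsMultilinear (C : AInfData.{u, v, w} k) {U : C.Obj → C.Obj → Type w'}
    [∀ X Y, AddCommGroup (U X Y)] [∀ X Y, Module k (U X Y)]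
    (φ : ∀ {X Y : C.Obj}, CSeq C.Tot X Y → U X Y) : Prop where
  map_add : ∀ {W X Y Z : C.Obj} (p : CSeq C.Tot W X) (f g : C.Tot X Y) (q : CSeq C.Tot Y Z),
    φ (p.append (CSeq.cons (f + g) q)) =
      φ (p.append (CSeq.cons f q)) + φ (p.append (CSeq.cons g q))
  map_smul : ∀ {W X Y Z : C.Obj} (p : CSeq C.Tot W X) (a : k) (f : C.Tot X Y)
    (q : CSeq C.Tot Y Z),
    φ (p.append (CSeq.cons (a • f) q)) = a • φ (p.append (CSeq.cons f q))

/-- For a function `φ` on composable sequences, the sum over all consecutive nonempty subsequences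
`∑ (-1)^‡ φ(f_d, …, f_{n+l+1}, m_l(f_{n+l}, …, f_{n+1}), f_n, …, f_1)` with the sign
`‡ = |f_n| + ⋯ + |f_1| - n`. -/
def insertSum (C : AInfData.{u, v, w} k) {U : C.Obj → C.Obj → Type w'}
    [∀ X Y, AddCommGroup (U X Y)] (φ : ∀ {X Y : C.Obj}, CSeq C.Tot X Y → U X Y)
    {X Y : C.Obj} (p : CSeq C.Tot X Y) : U X Y :=
  (p.cuts.map (fun c => (c.2.2.properCuts.map (fun e =>
    φ ((C.twist c.2.1).append (CSeq.cons (C.m e.2.1) e.2.2)))).sum)).sum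

/-- The axioms of a strictly unital `A_∞`-category. The operations `m_d` exist for `d ≥ 1`; the
value on empty sequences is zero by convention. -/
structure IsAInfCategory (C : AInfData.{u, v, w} k) : Prop where
  m_nil : ∀ X : C.Obj, C.m (CSeq.nil X) = 0
  multilinear : C.IsMultilinear (U := C.Tot) C.m
  degree : ∀ {X Y : C.Obj} (p : CSeq C.Tot X Y) (s : ℤ), C.HomogSeq p s →
    C.m p ∈ homogeneous k (C.Hom X Y) (s + 2 - p.length)
  relation : ∀ {X Y : C.Obj} (p : CSeq C.Tot X Y), C.insertSum (U := C.Tot) C.m p = 0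
  m_two_unit : ∀ {X Y : C.Obj} (f : C.Tot X Y), C.m (CSeq.pair f (C.unit X)) = f
  unit_m_two : ∀ {X Y : C.Obj} (g : C.Tot X Y),
    signMap k (C.Hom X Y) (C.m (CSeq.pair (C.unit Y) g)) = g
  m_unit : ∀ {W X Y : C.Obj} (p : CSeq C.Tot W X) (q : CSeq C.Tot X Y),
    p.length + q.length + 1 ≠ 2 → C.m (p.append (CSeq.cons (C.unit X) q)) = 0

/-- Given components `G`, all sequences `(G(p_r), …, G(p_1))` where `p_1, …, p_r` are the pieces
of a partition of `p` into `r` nonempty consecutive pieces. -/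
def blocks {C : AInfData.{u, v, w} k} {D : AInfData.{u, v, w} k} (F : C.Obj → D.Obj)
    (G : ∀ {X Y : C.Obj}, CSeq C.Tot X Y → D.Tot (F X) (F Y)) :
    ℕ → ∀ {X Y : C.Obj}, CSeq C.Tot X Y → List (CSeq D.Tot (F X) (F Y))
  | 0, _, _, CSeq.nil X => [CSeq.nil (F X)]
  | 0, _, _, CSeq.cons _ _ => []
  | r + 1, _, _, p => p.properCuts.flatMap (fun c =>
      (blocks F G r c.2.2).map (fun b => CSeq.cons (G c.2.1) b))

/-- `A_∞`-functors with map `F` on objects and components `G = {F^d}`, `F^d` being the restriction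
of `G` to sequences with `d` entries (`d ≥ 1`; the value on empty sequences is zero by
convention). -/
structure IsAInfFunctor (C D : AInfData.{u, v, w} k) (F : C.Obj → D.Obj)
    (G : ∀ {X Y : C.Obj}, CSeq C.Tot X Y → D.Tot (F X) (F Y)) : Prop where
  nil : ∀ X : C.Obj, G (CSeq.nil X) = 0
  multilinear : C.IsMultilinear (U := fun X Y => D.Tot (F X) (F Y)) G
  degree : ∀ {X Y : C.Obj} (p : CSeq C.Tot X Y) (s : ℤ), C.HomogSeq p s →
    G p ∈ homogeneous k (D.Hom (F X) (F Y)) (s + 1 - p.length)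
  relation : ∀ {X Y : C.Obj} (p : CSeq C.Tot X Y),
    ∑ r ∈ Finset.Icc 1 p.length, ((blocks F G r p).map D.m).sum =
      C.insertSum (U := fun X Y => D.Tot (F X) (F Y)) G p
  map_unit : ∀ X : C.Obj, G (CSeq.single (C.unit X)) = D.unit (F X)
  unit_zero : ∀ {W X Y : C.Obj} (p : CSeq C.Tot W X) (q : CSeq C.Tot X Y),
    2 ≤ p.length + q.length + 1 → G (p.append (CSeq.cons (C.unit X) q)) = 0

/-- The full subcategory on a set of objects, with the restricted operations. -/
def full (C : AInfData.{u, v, w} k) (s : Set C.Obj) : AInfData.{u, v, w} k where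
  Obj := s
  Hom X Y n := C.Hom X.1 Y.1 n
  m p := C.m (p.map Subtype.val (fun f => f))
  one X := C.one X.1

/-- The components of the inclusion of a full subcategory: the identity on single morphisms, zero
on longer sequences. -/
def fullIncl (C : AInfData.{u, v, w} k) (s : Set C.Obj) {X Y : (C.full s).Obj} :
    CSeq (C.full s).Tot X Y → C.Tot X.1 Y.1
  | CSeq.nil _ => 0
  | CSeq.cons f (CSeq.nil _) => f
  | CSeq.cons _ (CSeq.cons _ _) => 0

/-- The morphisms in `S` generate `C` under `k`-linear combinations and `m_2`, starting from the
identities. -/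
def IsGeneratedBy (C : AInfData.{u, v, w} k) (S : Set (Σ X Y : C.Obj, C.Tot X Y)) : Prop :=
  ∀ W : ∀ X Y : C.Obj, Submodule k (C.Tot X Y),
    (∀ X, C.unit X ∈ W X X) → (∀ f ∈ S, f.2.2 ∈ W f.1 f.2.1) →
    (∀ {X Y Z : C.Obj} (g : C.Tot Y Z) (f : C.Tot X Y), g ∈ W Y Z → f ∈ W X Y →
      C.m (CSeq.pair g f) ∈ W X Z) →
    ∀ X Y, W X Y = ⊤

end AInfData

/-! ### The dg category of a family of complexes and homotopy transfer to its cohomology -/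

section Transfer

open CochainComplex.HomComplex

variable (k : Type u) [CommRing k] {𝒞 : Type v} [Category.{w} 𝒞] [Preadditive 𝒞] [Linear k 𝒞]

/-- The cocycles of degree `n` in the complex of morphisms from `K` to `L`. -/
def cocycles (K L : CochainComplex 𝒞 ℤ) (n : ℤ) : Submodule k (Cochain K L n) :=
  LinearMap.ker (δ_hom k K L n (n + 1))

/-- The cohomology in degree `n` of the complex of morphisms from `K` to `L`. -/
abbrev HomCohomology (K L : CochainComplex 𝒞 ℤ) (n : ℤ) : Type w :=
  cocycles k K L n ⧸ (LinearMap.range (δ_hom k K L (n - 1) n)).submoduleOf (cocycles k K L n)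

/-- The cohomology class of a cocycle. -/
def cohClass {K L : CochainComplex 𝒞 ℤ} {n : ℤ} (z : Cochain K L n) (hz : δ n (n + 1) z = 0) :
    HomCohomology k K L n :=
  Submodule.Quotient.mk ⟨z, hz⟩

/-- The composition `g ∘ f` of cochains, with the sign `(-1) ^ |f|`, on total morphism modules. -/
def signedComp (K L M : CochainComplex 𝒞 ℤ) :
    (⨁ n, Cochain L M n) →ₗ[k] (⨁ n, Cochain K L n) →ₗ[k] ⨁ n, Cochain K M n :=
  DirectSum.toModule k ℤ _ (fun b => LinearMap.flip (DirectSum.toModule k ℤ _ (fun a =>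
    LinearMap.mk₂ k
      (fun (f : Cochain K L a) (g : Cochain L M b) =>
        (a.negOnePow : ℤ) • DirectSum.lof k ℤ (Cochain K M) (a + b) (f.comp g rfl))
      (fun f f' g => by rw [Cochain.add_comp, map_add, smul_add])
      (fun c f g => by rw [Cochain.smul_comp, map_smul, smul_comm])
      (fun f g g' => by rw [Cochain.comp_add, map_add, smul_add])
      (fun c f g => by rw [Cochain.comp_smul, map_smul, smul_comm]))))

variable {ι : Type w'} (K : ι → CochainComplex 𝒞 ℤ)

/-- A contraction of the dg category with objects `ι` and morphism complexes
`Hom^*(K X, K Y)` onto its cohomology: maps `i`, `p` of degree `0` and `H` of degree `-1` with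
`p i = 1`, `1 - i p = d H + H d`, `H H = 0` and `H i = 0`. Here `i` chooses a cocycle in each
cohomology class. Only the values `H X Y n m` with `m + 1 = n` matter. -/
structure Contraction where
  i : ∀ (X Y : ι) (n : ℤ), HomCohomology k (K X) (K Y) n →ₗ[k] cocycles k (K X) (K Y) n
  p : ∀ (X Y : ι) (n : ℤ), Cochain (K X) (K Y) n →ₗ[k] HomCohomology k (K X) (K Y) n
  H : ∀ (X Y : ι) (n m : ℤ), Cochain (K X) (K Y) n →ₗ[k] Cochain (K X) (K Y) m
  class_i : ∀ (X Y : ι) (n : ℤ) (x : HomCohomology k (K X) (K Y) n),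
    Submodule.Quotient.mk (i X Y n x) = x
  p_δ : ∀ (X Y : ι) (n m : ℤ), n + 1 = m → ∀ f : Cochain (K X) (K Y) n, p X Y m (δ n m f) = 0
  p_i : ∀ (X Y : ι) (n : ℤ) (x : HomCohomology k (K X) (K Y) n),
    p X Y n (i X Y n x : Cochain (K X) (K Y) n) = x
  homotopy : ∀ (X Y : ι) (l n m : ℤ), l + 1 = n → n + 1 = m → ∀ f : Cochain (K X) (K Y) n,
    f - (i X Y n (p X Y n f) : Cochain (K X) (K Y) n) =
      δ l n (H X Y n l f) + H X Y m n (δ n m f)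
  H_H : ∀ (X Y : ι) (l n m : ℤ), l + 1 = n → n + 1 = m → ∀ f : Cochain (K X) (K Y) m,
    H X Y n l (H X Y m n f) = 0
  H_i : ∀ (X Y : ι) (l n : ℤ), l + 1 = n → ∀ x : HomCohomology k (K X) (K Y) n,
    H X Y n l (i X Y n x : Cochain (K X) (K Y) n) = 0

variable {k K}

namespace Contraction

variable (c : Contraction k K)

/-- `i` on total morphism modules. -/
def iTot (X Y : ι) : (⨁ n, HomCohomology k (K X) (K Y) n) →ₗ[k] ⨁ n, Cochain (K X) (K Y) n :=
  DirectSum.toModule k ℤ _ (fun n =>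
    DirectSum.lof k ℤ (Cochain (K X) (K Y)) n ∘ₗ (cocycles k (K X) (K Y) n).subtype ∘ₗ c.i X Y n)

/-- `p` on total morphism modules. -/
def pTot (X Y : ι) : (⨁ n, Cochain (K X) (K Y) n) →ₗ[k] ⨁ n, HomCohomology k (K X) (K Y) n :=
  DirectSum.toModule k ℤ _ (fun n =>
    DirectSum.lof k ℤ (HomCohomology k (K X) (K Y)) n ∘ₗ c.p X Y n)

/-- `f ↦ (-1) ^ |f| H f` on total morphism modules. -/
def hTot (X Y : ι) : (⨁ n, Cochain (K X) (K Y) n) →ₗ[k] ⨁ n, Cochain (K X) (K Y) n :=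
  DirectSum.toModule k ℤ _ (fun n =>
    (n.negOnePow : ℤ) • (DirectSum.lof k ℤ (Cochain (K X) (K Y)) (n - 1) ∘ₗ c.H X Y n (n - 1)))

/-- The value of a tree at its outgoing edge when that edge is internal: leaves are labelled by
`i`, branch points by the (signed) composition and internal edges by the (signed) homotopy. -/
def edgeValue : ∀ {X Y : ι}, BTree (fun X Y => ⨁ n, HomCohomology k (K X) (K Y) n) X Y →
    ⨁ n, Cochain (K X) (K Y) n
  | X, Y, BTree.leaf f => c.iTot X Y f
  | _, _, BTree.node (X := X) (Y := Y) (Z := Z) l r =>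
      c.hTot X Z (signedComp k (K X) (K Y) (K Z) (edgeValue r) (edgeValue l))

/-- The operation defined by a tree: as `edgeValue`, but with the root labelled by `p`. The tree
with one leaf contributes `m_1 = 0`, the differential of the cohomology. -/
def rootValue {X Y : ι} : BTree (fun X Y => ⨁ n, HomCohomology k (K X) (K Y) n) X Y →
    ⨁ n, HomCohomology k (K X) (K Y) n
  | BTree.leaf _ => 0
  | BTree.node (X := X) (Y := Y) (Z := Z) l r =>
      c.pTot X Z (signedComp k (K X) (K Y) (K Z) (c.edgeValue r) (c.edgeValue l))

/-- The transferred `A_∞`-structure on the cohomology, `m_d = ∑ m_d^T` over planar binary trees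
with `d` leaves; the identities are the classes of the identity maps. -/
def transfer : AInfData.{u, w', w} k where
  Obj := ι
  Hom X Y n := HomCohomology k (K X) (K Y) n
  m q := (q.trees.map c.rootValue).sum
  one X := cohClass k (Cochain.ofHom (𝟙 (K X))) (by simp)

end Contraction

end Transfer

/-! ### The preprojective algebra of the `A_2` quiver, its modules and their resolutions -/

/-- The preprojective algebra of type `A_2`. The vertices are the elements of `ZMod 2` (so
vertex `1` is `1` and vertex `2` is `0`); an element has a coordinate `e i` at the trivial path `(i)`
and a coordinate `a i` at the arrow `i → i + 1`, for each vertex `i`. -/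
@[ext]
structure PiA2 (k : Type u) where
  e : ZMod 2 → k
  a : ZMod 2 → k

namespace PiA2

variable {k : Type u} [Field k]

instance : Zero (PiA2 k) := ⟨⟨0, 0⟩⟩
instance : One (PiA2 k) := ⟨⟨1, 0⟩⟩
instance : Add (PiA2 k) := ⟨fun x y => ⟨x.e + y.e, x.a + y.a⟩⟩
instance : Neg (PiA2 k) := ⟨fun x => ⟨-x.e, -x.a⟩⟩
instance : SMul k (PiA2 k) := ⟨fun c x => ⟨c • x.e, c • x.a⟩⟩
/-- In a product `x * y` of paths `y` comes first; products of two arrows vanish. -/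
instance : Mul (PiA2 k) :=
  ⟨fun x y => ⟨fun i => x.e i * y.e i, fun i => x.e (i + 1) * y.a i + x.a i * y.e i⟩⟩

@[simp] lemma zero_e (i : ZMod 2) : (0 : PiA2 k).e i = 0 := rfl
@[simp] lemma zero_a (i : ZMod 2) : (0 : PiA2 k).a i = 0 := rfl
@[simp] lemma one_e (i : ZMod 2) : (1 : PiA2 k).e i = 1 := rfl
@[simp] lemma one_a (i : ZMod 2) : (1 : PiA2 k).a i = 0 := rfl
@[simp] lemma add_e (x y : PiA2 k) (i : ZMod 2) : (x + y).e i = x.e i + y.e i := rfl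
@[simp] lemma add_a (x y : PiA2 k) (i : ZMod 2) : (x + y).a i = x.a i + y.a i := rfl
@[simp] lemma neg_e (x : PiA2 k) (i : ZMod 2) : (-x).e i = -x.e i := rfl
@[simp] lemma neg_a (x : PiA2 k) (i : ZMod 2) : (-x).a i = -x.a i := rfl
@[simp] lemma smul_e (c : k) (x : PiA2 k) (i : ZMod 2) : (c • x).e i = c * x.e i := rfl
@[simp] lemma smul_a (c : k) (x : PiA2 k) (i : ZMod 2) : (c • x).a i = c * x.a i := rfl
@[simp] lemma mul_e (x y : PiA2 k) (i : ZMod 2) : (x * y).e i = x.e i * y.e i := rfl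
@[simp] lemma mul_a (x y : PiA2 k) (i : ZMod 2) :
    (x * y).a i = x.e (i + 1) * y.a i + x.a i * y.e i := rfl

instance : Ring (PiA2 k) where
  add_assoc x y z := by ext i <;> simp [add_assoc]
  zero_add x := by ext i <;> simp
  add_zero x := by ext i <;> simp
  add_comm x y := by ext i <;> simp [add_comm]
  neg_add_cancel x := by ext i <;> simp
  mul_assoc x y z := by ext i <;> simp <;> ring
  one_mul x := by ext i <;> simp
  mul_one x := by ext i <;> simp
  left_distrib x y z := by ext i <;> simp <;> ring
  right_distrib x y z := by ext i <;> simp <;> ring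
  zero_mul x := by ext i <;> simp
  mul_zero x := by ext i <;> simp
  nsmul := nsmulRec
  zsmul := zsmulRec

instance : Module k (PiA2 k) where
  one_smul x := by ext i <;> simp
  mul_smul c d x := by ext i <;> simp [mul_assoc]
  smul_zero c := by ext i <;> simp
  smul_add c x y := by ext i <;> simp [mul_add]
  add_smul c d x := by ext i <;> simp [add_mul]
  zero_smul x := by ext i <;> simp

instance : Algebra k (PiA2 k) :=
  Algebra.ofModule (fun c x y => by ext i <;> simp <;> ring)
    (fun c x y => by ext i <;> simp <;> ring)

/-- The trivial path `(i)` at the vertex `i`. -/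
def idem (i : ZMod 2) : PiA2 k := ⟨Pi.single i 1, 0⟩

/-- The arrow `i → i + 1`. -/
def arr (i : ZMod 2) : PiA2 k := ⟨0, Pi.single i 1⟩

lemma arr_mul_arr (i j : ZMod 2) : (arr i * arr j : PiA2 k) = 0 := by
  ext l <;> simp [arr]

lemma idem_mul_idem (i : ZMod 2) : (idem i * idem i : PiA2 k) = idem i := by
  ext l <;> simp [idem, Pi.single_apply]

lemma arr_mul_idem (i : ZMod 2) : (arr i * idem i : PiA2 k) = arr i := by
  ext l <;> simp [idem, arr, Pi.single_apply]

variable (k)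

/-- The projective module `P_i`, the left ideal generated by `(i)`. -/
def proj (i : ZMod 2) : Submodule (PiA2 k) (PiA2 k) := Submodule.span (PiA2 k) {idem i}

variable {k}

lemma mem_proj (i : ZMod 2) (x : PiA2 k) : x ∈ proj k i ↔ x * idem i = x := by
  rw [proj, Submodule.mem_span_singleton]
  constructor
  · rintro ⟨y, rfl⟩
    rw [smul_eq_mul, mul_assoc, idem_mul_idem]
  · intro h
    exact ⟨x, h⟩

instance (i : ZMod 2) : Module.Projective (PiA2 k) (proj k i) :=
  Module.Projective.of_split (proj k i).subtype
    ((LinearMap.toSpanSingleton (PiA2 k) (PiA2 k) (idem i)).codRestrict _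
      (fun x => by
        rw [mem_proj, LinearMap.toSpanSingleton_apply, smul_eq_mul, mul_assoc, idem_mul_idem]))
    (LinearMap.ext fun x => Subtype.ext ((mem_proj i x.1).1 x.2))

end PiA2

/-- The objects of the preprojective category: the four indecomposable modules `S_1`, `S_2`
(simple) and `P_1`, `P_2` (projective). -/
inductive PObj : Type
  | S (i : ZMod 2)
  | P (i : ZMod 2)

namespace PObj

open PiA2

variable (k : Type u) [Field k]

/-- The terms of the complexes of projectives that represent the four modules. For `P_i` it is
`P_i` in degree `0`. For `S_i` it is the resolution `⋯ → P_i → P_{i+1} → P_i`, with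
`P_{i+n}` in degree `n ≤ 0`. -/
def term : PObj → ℤ → Submodule (PiA2 k) (PiA2 k)
  | S i, n => if n ≤ 0 then proj k (i + n) else ⊥
  | P i, n => if n = 0 then proj k i else ⊥

/-- The differential `P_{i+n} → P_{i+n+1}` of the resolution of `S_i` is right multiplication by
the arrow `i+n+1 → i+n`; this is the element by which one has to multiply. -/
def dElt : PObj → ℤ → ℤ → PiA2 k
  | S i, n, m => if n + 1 = m ∧ m ≤ 0 then arr (i + m) else 0
  | P _, _, _ => 0

variable {k}

lemma mul_dElt_mem (X : PObj) (n m : ℤ) (x : PiA2 k) : x * dElt k X n m ∈ term k X m := by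
  cases X with
  | P i => simp [dElt]
  | S i =>
    by_cases h : n + 1 = m ∧ m ≤ 0
    · simp only [dElt, term, if_pos h, if_pos h.2, mem_proj, mul_assoc, arr_mul_idem]
    · simp [dElt, if_neg h]

lemma dElt_mul_dElt (X : PObj) (n m l : ℤ) : dElt k X n m * dElt k X m l = 0 := by
  cases X with
  | P i => simp [dElt]
  | S i => simp only [dElt]; split_ifs <;> simp [arr_mul_arr]

/-- Right multiplication by an element of the algebra, between submodules of the algebra. -/
def rightMul (A B : Submodule (PiA2 k) (PiA2 k)) (y : PiA2 k) (h : ∀ x ∈ A, x * y ∈ B) :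
    ModuleCat.of (PiA2 k) A ⟶ ModuleCat.of (PiA2 k) B :=
  ModuleCat.ofHom ((LinearMap.toSpanSingleton (PiA2 k) (PiA2 k) y).restrict h)

lemma rightMul_apply {A B : Submodule (PiA2 k) (PiA2 k)} {y : PiA2 k} {h : ∀ x ∈ A, x * y ∈ B}
    (x : A) : (((rightMul A B y h).hom x : B) : PiA2 k) = x * y := rfl

variable (k)

/-- The complex of projectives that represents an indecomposable module. -/
def cpx (X : PObj) : CochainComplex (ModuleCat.{u} (PiA2 k)) ℤ where
  X n := ModuleCat.of (PiA2 k) (term k X n)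
  d n m := rightMul _ _ (dElt k X n m) (fun x _ => mul_dElt_mem X n m x)
  shape n m h := by
    have h0 : dElt k X n m = 0 := by
      cases X with
      | P i => rfl
      | S i => exact if_neg (fun h' => h h'.1)
    refine ModuleCat.hom_ext (LinearMap.ext fun x => Subtype.ext ?_)
    change (x : PiA2 k) * dElt k X n m = 0
    rw [h0, mul_zero]
  d_comp_d' n m l _ _ := by
    refine ModuleCat.hom_ext (LinearMap.ext fun x => Subtype.ext ?_)
    change (x : PiA2 k) * dElt k X n m * dElt k X m l = 0
    rw [mul_assoc, dElt_mul_dElt, mul_zero]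

variable {k}

/-- The complex of `S_i` is exact in negative degrees. -/
lemma exact_neg (i : ZMod 2) (n : ℤ) (hn : n < 0) (x : PiA2 k) (hx : x ∈ term k (S i) n)
    (h : x * dElt k (S i) n (n + 1) = 0) :
    ∃ y ∈ term k (S i) (n - 1), y * dElt k (S i) (n - 1) n = x := by
  rw [term, if_pos hn.le, mem_proj] at hx
  rw [dElt, if_pos ⟨rfl, by lia⟩] at h
  have h2 : ∀ l : ZMod 2, l + 1 + 1 = l := by decide
  have h3 : ∀ l m : ZMod 2, l ≠ m → l = m + 1 := by decide
  have hc : ((n - 1 : ℤ) : ZMod 2) = n + 1 := by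
    push_cast; generalize (n : ZMod 2) = t; revert t; decide
  have hc' : ((n + 1 : ℤ) : ZMod 2) = n + 1 := by push_cast; rfl
  refine ⟨x.a (i + n) • idem (i + n + 1), ?_, ?_⟩
  · rw [term, if_pos (by lia), mem_proj, hc, ← add_assoc, smul_mul_assoc, idem_mul_idem]
  · rw [dElt, if_pos ⟨by lia, hn.le⟩]
    have he : x.e (i + n) = 0 := by
      have := congrArg (fun z => a z (i + n + 1)) h
      simpa [arr, hc', ← add_assoc, h2] using this
    rw [← hx]
    ext l <;> by_cases hl : l = i + n <;> simp [idem, arr, Pi.single_apply, hl, he]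

/-- In degree zero the image of the differential of the complex of `S_i` is the kernel of
`P_i → S_i`, where `S_i` is `k` with `x` acting as multiplication by `x.e i`. -/
lemma exact_zero (i : ZMod 2) (x : PiA2 k) (hx : x ∈ term k (S i) 0) :
    (∃ y ∈ term k (S i) (-1), y * dElt k (S i) (-1) 0 = x) ↔ x.e i = 0 := by
  rw [term, if_pos le_rfl, mem_proj, Int.cast_zero, add_zero] at hx
  rw [dElt, if_pos ⟨by lia, le_rfl⟩, term, if_pos (by lia), Int.cast_zero, add_zero]
  constructor
  · rintro ⟨y, -, rfl⟩
    simp [arr]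
  · intro h
    refine ⟨x.a i • idem (i + ((-1 : ℤ) : ZMod 2)), ?_, ?_⟩
    · rw [mem_proj, smul_mul_assoc, idem_mul_idem]
    · have hc : ((-1 : ℤ) : ZMod 2) = 1 := by decide
      rw [← hx]
      ext l <;> by_cases hl : l = i <;> simp [idem, arr, Pi.single_apply, hl, h, hc]

/-- The element `(-1) ^ m (i + m)`, or zero when `m > 0`. -/
def extElt (k : Type u) [Field k] (i : ZMod 2) (m : ℤ) : PiA2 k :=
  if m ≤ 0 then (m.negOnePow : ℤ) • idem (i + m) else 0

lemma mul_extElt_mem (i : ZMod 2) (m : ℤ) (x : PiA2 k) : x * extElt k i m ∈ term k (S i) m := by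
  by_cases h : m ≤ 0
  · simp only [extElt, term, if_pos h, mem_proj, mul_assoc, smul_mul_assoc, idem_mul_idem]
  · simp [extElt, if_neg h]

open CochainComplex.HomComplex

/-- The map of degree `1` from the resolution of `S_j` to that of `S_i` whose component into
degree `m ≤ 0` is right multiplication by `(-1) ^ m (i + m)`. For `j = i + 1` this component is
`(-1) ^ m` times the identity of `P_{i+m}`. -/
def extCochain (k : Type u) [Field k] (j i : ZMod 2) : Cochain (cpx k (S j)) (cpx k (S i)) 1 :=
  Cochain.mk (fun _ m _ => rightMul _ _ (extElt k i m) (fun x _ => mul_extElt_mem i m x))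

lemma idem_arr_comm (j i t : ZMod 2) :
    (idem (j + t) * (idem (i + t + 1) * arr (i + t)) : PiA2 k) =
      idem (j + t) * (arr (j + t + 1) * idem (i + t)) := by
  have h2 : ∀ l : ZMod 2, l + 1 + 1 = l := by decide
  have h3 : j = i ∨ j = i + 1 := by revert i j; decide
  have h4 : ∀ l : ZMod 2, l ≠ l + 1 := by decide
  rcases h3 with rfl | rfl
  · ext l
    · simp [idem, arr]
    · simp only [idem, arr, mul_a, mul_e, Pi.single_apply, Pi.zero_apply, add_left_inj]
      split_ifs <;> simp_all
  · rw [add_right_comm i 1 t, h2]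
    ext l
    · simp [idem, arr]
    · simp only [idem, arr, mul_a, mul_e, Pi.single_apply, Pi.zero_apply, add_left_inj]
      split_ifs <;> simp_all

lemma δ_extCochain (j i : ZMod 2) : δ 1 (1 + 1) (extCochain k j i) = 0 := by
  ext n m hnm : 1
  rw [δ_v 1 (1 + 1) rfl _ n m hnm (n + 1) (n + 1) (by lia) rfl]
  rw [show (1 + 1 : ℤ).negOnePow = 1 from rfl, one_smul]
  refine ModuleCat.hom_ext (LinearMap.ext fun ⟨x, h⟩ => Subtype.ext ?_)
  change x * extElt k i (n + 1) * dElt k (S i) (n + 1) m +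
    x * dElt k (S j) n (n + 1) * extElt k i m = 0
  by_cases hm : m ≤ 0
  · obtain rfl : m = n + 1 + 1 := by lia
    have hx : x * idem (j + n) = x := by
      rw [term, if_pos (by lia), mem_proj] at h
      exact h
    have h2 : ∀ l : ZMod 2, l + 1 + 1 = l := by decide
    simp only [extElt, dElt, if_pos hm, if_pos (show n + 1 ≤ 0 by lia), true_and, Int.cast_add,
      Int.cast_one, Int.negOnePow_succ, Units.val_neg, neg_smul, mul_neg, neg_neg, neg_mul,
      mul_smul_comm, smul_mul_assoc, ← add_assoc, h2]
    rw [neg_add_eq_zero, mul_assoc, mul_assoc, ← hx, mul_assoc, mul_assoc x,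
      idem_arr_comm]
  · simp [extElt, dElt, hm]

/-- The class in `Ext^1(S_j, S_i)`, for `j = i + 1`, of the short exact sequence
`0 → S_i → P_j → S_j → 0`. -/
def extClass (k : Type u) [Field k] (j i : ZMod 2) :
    HomCohomology k (cpx k (S j)) (cpx k (S i)) 1 :=
  cohClass k (extCochain k j i) (δ_extCochain (k := k) j i)

end PObj

/-! ### The preprojective category and its subcategory of simples -/

section Preprojective

open PObj

variable {k : Type u} [Field k]

/-- The preprojective category: the `Ext`-algebra of the sum of the four indecomposable modules
with the `A_∞`-structure transferred along a contraction `c`. -/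
def preproj (c : Contraction k (cpx k)) : AInfData.{u, 0, u} k := c.transfer

/-- The full subcategory on the simple modules. -/
def simples (c : Contraction k (cpx k)) : AInfData.{u, 0, u} k :=
  (preproj c).full {X : PObj | ∃ i, X = PObj.S i}

/-- The simple module `S_i` as an object of the subcategory of simples. -/
def simple (c : Contraction k (cpx k)) (i : ZMod 2) : (simples c).Obj := ⟨PObj.S i, i, rfl⟩

/-- `α : S_2 → S_1`, of degree `1`. -/
def alpha (c : Contraction k (cpx k)) : (simples c).Tot (simple c 2) (simple c 1) :=
  DirectSum.lof k ℤ ((simples c).Hom (simple c 2) (simple c 1)) 1 (extClass k 2 1)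

/-- `β : S_1 → S_2`, of degree `1`. -/
def beta (c : Contraction k (cpx k)) : (simples c).Tot (simple c 1) (simple c 2) :=
  DirectSum.lof k ℤ ((simples c).Hom (simple c 1) (simple c 2)) 1 (extClass k 1 2)

/-- The components of the inclusion of the simples into the preprojective category. -/
def incl (c : Contraction k (cpx k)) {X Y : (simples c).Obj} :
    CSeq (simples c).Tot X Y → (preproj c).Tot X.1 Y.1 :=
  (preproj c).fullIncl {X : PObj | ∃ i, X = PObj.S i}

end Preprojective

end

/-! The theorem combines a general transfer argument, valid for any contraction whose identities
represent themselves, with a parity argument for the two simple modules.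

Transfer. Write h and d for the signed homotopy and differential, F(p) for the sum of the edge
values of all trees on a sequence p, and B(p) for the sum of their values at the lowest branch
point, before h or p is applied. Trees then disappear in favour of a recursion (`edgeSum_succ`): F
is i on single morphisms plus hB, B is the sum over all cuts of products of two values of F, and the
operations are pB. The identity dh = ip - 1 - hd turns a formula for dB into dF = F∘m - B, where F∘m
is the signed sum over insertions. Substituting this into the Leibniz rule, the terms with B cancel
by associativity, and induction on length gives dB = -B∘m (`dTot_branchSum`). Since pd = 0, applying
p yields the A-infinity relations. Strict unitality needs i to send the class of each identity to
the identity itself, which holds because the endomorphism complexes have no coboundaries in degree 0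
(`isUnital_cpx`). A unit at the end of a sequence then turns B into F up to sign, and F is killed by
h, and by p on at least two entries.

Parity. A component of a degree n cochain from the resolution of S_j to that of S_i is right
multiplication by an element of (j+p)Π(i+p+n). This is a multiple of an idempotent if n ≡ j - i mod
2, and of an arrow otherwise. Products of two arrows vanish, so there are no coboundaries in the
first kind of degree (`δ_eq_zero`); in the second kind everything is a coboundary (`exists_δ_eq`).
Hence each class has only one representing cocycle, for every contraction, and these representatives
are closed under composition (`signedComp_mem_range_iTot`). As Hi = 0, every internal edge
contributes zero and nothing beyond m_2 survives.

Generation. The degree one cocycle is plus or minus the identity in every component that can be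
nonzero, so every cocycle of positive degree factors through it exactly (`exists_comp_extCochain`);
cocycles of degree 0 are scalars and those of negative degree vanish. Finally, a functor without
higher components is multiplicative since m_1 = 0, so the morphisms it fixes form a subcategory; if
this contains α and β it is everything. -/

noncomputable section

/-! ### Sums over cuts and insertions -/

namespace CSeq

variable {Obj : Type v} {T : Obj → Obj → Type w} {A : Type*} [AddCommMonoid A]

/-- The sum of a function over all ways of cutting a sequence into two pieces. -/
def cutSum {X Z : Obj} (ψ : ∀ Y, CSeq T X Y → CSeq T Y Z → A) (p : CSeq T X Z) : A :=
  (p.cuts.map (fun c => ψ c.1 c.2.1 c.2.2)).sum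

@[simp] lemma cutSum_nil {X : Obj} (ψ : ∀ Y, CSeq T X Y → CSeq T Y X → A) :
    cutSum ψ (nil X) = ψ X (nil X) (nil X) := by
  simp [cutSum, cuts]

lemma cutSum_cons {X Y Z : Obj} (ψ : ∀ Y, CSeq T X Y → CSeq T Y Z → A) (f : T X Y)
    (p : CSeq T Y Z) :
    cutSum ψ (cons f p) = ψ X (nil X) (cons f p) + cutSum (fun W a b => ψ W (cons f a) b) p := by
  simp [cutSum, cuts, Function.comp_def]

lemma length_of_mem_cuts {X Z : Obj} (p : CSeq T X Z) :
    ∀ c ∈ p.cuts, c.2.1.length + c.2.2.length = p.length := by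
  induction p with
  | nil X => simp [cuts, length]
  | cons f p ih =>
    intro c hc
    simp only [cuts, List.mem_cons, List.mem_map] at hc
    rcases hc with rfl | ⟨d, hd, rfl⟩
    · simp [length]
    · have := ih d hd
      simp only [length]
      omega

lemma cutSum_congr {X Z : Obj} {ψ ψ' : ∀ Y, CSeq T X Y → CSeq T Y Z → A} (p : CSeq T X Z)
    (h : ∀ Y a b, length a + length b = p.length → ψ Y a b = ψ' Y a b) :
    cutSum ψ p = cutSum ψ' p := by
  unfold cutSum
  congr 1
  exact List.map_congr_left fun c hc => h _ _ _ (length_of_mem_cuts p c hc)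

lemma cutSum_zero {X Z : Obj} (p : CSeq T X Z) :
    cutSum (fun _ _ _ => (0 : A)) p = 0 := by
  induction p with
  | nil X => simp
  | cons f p ih => rw [cutSum_cons, ih, add_zero]

lemma cutSum_add {X Z : Obj} (ψ ψ' : ∀ Y, CSeq T X Y → CSeq T Y Z → A) (p : CSeq T X Z) :
    cutSum (fun Y a b => ψ Y a b + ψ' Y a b) p = cutSum ψ p + cutSum ψ' p := by
  induction p with
  | nil X => simp
  | cons f p ih => rw [cutSum_cons, cutSum_cons, cutSum_cons, ih]; abel

lemma map_cutSum {B G : Type*} [AddCommMonoid B] [FunLike G A B] [AddMonoidHomClass G A B] (g : G)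
    {X Z : Obj} (ψ : ∀ Y, CSeq T X Y → CSeq T Y Z → A) (p : CSeq T X Z) :
    g (cutSum ψ p) = cutSum (fun Y a b => g (ψ Y a b)) p := by
  simp [cutSum, map_list_sum, Function.comp_def]

lemma cutSum_mem {S : Type*} [SetLike S A] [AddSubmonoidClass S A] (s : S) {X Z : Obj}
    (ψ : ∀ Y, CSeq T X Y → CSeq T Y Z → A) (p : CSeq T X Z)
    (h : ∀ c ∈ p.cuts, ψ c.1 c.2.1 c.2.2 ∈ s) : cutSum ψ p ∈ s := by
  refine list_sum_mem fun x hx => ?_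
  obtain ⟨c, hc, rfl⟩ := List.mem_map.1 hx
  exact h c hc

/-- Cutting is coassociative. -/
lemma cutSum_cutSum {X Z : Obj} (ψ : ∀ Y W, CSeq T X Y → CSeq T Y W → CSeq T W Z → A)
    (p : CSeq T X Z) :
    cutSum (fun Y a r => cutSum (fun W b c => ψ Y W a b c) r) p =
      cutSum (fun W l c => cutSum (fun Y a b => ψ Y W a b c) l) p := by
  induction p with
  | nil X => simp
  | cons f p ih => simp only [cutSum_cons, cutSum_nil, cutSum_add, ih, add_assoc]

/-- Each cut lies either before or after the marked entry `f`. This is the form used for linearity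
in `f` and for units. -/
lemma cutSum_append_cons {X Y Y' Z : Obj} (ψ : ∀ Y, CSeq T X Y → CSeq T Y Z → A)
    (p : CSeq T X Y) (f : T Y Y') (q : CSeq T Y' Z) :
    cutSum ψ (p.append (cons f q)) =
      cutSum (fun W a b => ψ W a (b.append (cons f q))) p +
        cutSum (fun W a b => ψ W (p.append (cons f a)) b) q := by
  induction p with
  | nil X => simp [append, cutSum_cons]
  | cons g p ih => simp only [append, cutSum_cons, ih, add_assoc]

/-- Only the cut with empty first piece contributes. -/
lemma cutSum_eq_nil_left {X Z : Obj} (ψ : ∀ Y, CSeq T X Y → CSeq T Y Z → A) (p : CSeq T X Z)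
    (h : ∀ Y a b, 1 ≤ length a → ψ Y a b = 0) : cutSum ψ p = ψ X (nil X) p := by
  cases p with
  | nil X => simp
  | cons f p =>
    rw [cutSum_cons, cutSum_congr p fun Y a b _ => h Y (cons f a) b (by simp [length]), cutSum_zero,
      add_zero]

/-- Only the cut with empty second piece contributes. -/
lemma cutSum_eq_nil_right {X Z : Obj} (ψ : ∀ Y, CSeq T X Y → CSeq T Y Z → A) (p : CSeq T X Z)
    (h : ∀ Y a b, 1 ≤ length b → ψ Y a b = 0) : cutSum ψ p = ψ Z p (nil Z) := by
  induction p with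
  | nil X => simp
  | cons f p ih =>
    rw [cutSum_cons, h _ _ _ (by simp [length]), zero_add, ih _ fun Y a b hb => h _ _ b hb]

lemma cutSum_map {Obj' : Type w'} {T' : Obj' → Obj' → Type w} (F : Obj → Obj')
    (φ : ∀ {X Y : Obj}, T X Y → T' (F X) (F Y)) {X Z : Obj}
    (ψ : ∀ Y, CSeq T' (F X) Y → CSeq T' Y (F Z) → A) (p : CSeq T X Z) :
    cutSum ψ (p.map F φ) = cutSum (fun Y a b => ψ (F Y) (a.map F φ) (b.map F φ)) p := by
  induction p with
  | nil X => simp [map]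
  | cons f p ih => simp only [map, cutSum_cons, ih]

@[simp] lemma length_append {X Y Z : Obj} (p : CSeq T X Y) (q : CSeq T Y Z) :
    (p.append q).length = p.length + q.length := by
  induction p with
  | nil X => simp [append, length]
  | cons f p ih => simp only [append, length, ih]; omega

@[simp] lemma length_map {Obj' : Type w'} {T' : Obj' → Obj' → Type w} (F : Obj → Obj')
    (φ : ∀ {X Y : Obj}, T X Y → T' (F X) (F Y)) {X Z : Obj} (p : CSeq T X Z) :
    (p.map F φ).length = p.length := by
  induction p with
  | nil X => rfl
  | cons f p ih => simp only [map, length, ih]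

lemma map_append {Obj' : Type w'} {T' : Obj' → Obj' → Type w} (F : Obj → Obj')
    (φ : ∀ {X Y : Obj}, T X Y → T' (F X) (F Y)) {X Y Z : Obj} (p : CSeq T X Y) (q : CSeq T Y Z) :
    (p.append q).map F φ = (p.map F φ).append (q.map F φ) := by
  induction p with
  | nil X => rfl
  | cons f p ih => simp only [map, append, ih]

/-- The sum over all insertions of an operation `m` into a sequence, where the entries before the
insertion are changed by `σ`. -/
def ins (m : ∀ {X Y : Obj}, CSeq T X Y → T X Y) (σ : ∀ {X Y : Obj}, T X Y → T X Y) {X Y : Obj}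
    (φ : CSeq T X Y → A) (p : CSeq T X Y) : A :=
  (p.cuts.map (fun c => (c.2.2.properCuts.map (fun e =>
    φ ((c.2.1.map id σ).append (CSeq.cons (m e.2.1) e.2.2)))).sum)).sum

variable (m : ∀ {X Y : Obj}, CSeq T X Y → T X Y) (σ : ∀ {X Y : Obj}, T X Y → T X Y)

@[simp] lemma ins_nil {X : Obj} (φ : CSeq T X X → A) : ins m σ φ (nil X) = 0 := by
  simp [ins, cuts, properCuts]

/-- An insertion either swallows the first entry or leaves it in front, where it acquires the sign
`σ`. -/
lemma ins_cons {X Y Z : Obj} (φ : CSeq T X Z → A) (f : T X Y) (p : CSeq T Y Z) :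
    ins m σ φ (cons f p) = cutSum (fun _ b c => φ (cons (m (cons f b)) c)) p +
      ins m σ (fun q => φ (cons (σ f) q)) p := by
  simp only [ins, cuts, List.map_cons, List.sum_cons, List.map_map, properCuts, cutSum]
  rfl

lemma ins_add {X Y : Obj} (φ φ' : CSeq T X Y → A) (p : CSeq T X Y) :
    ins m σ (fun q => φ q + φ' q) p = ins m σ φ p + ins m σ φ' p := by
  induction p with
  | nil X => simp
  | cons f p ih => rw [ins_cons, ins_cons, ins_cons, cutSum_add, ih]; abel

lemma map_ins {B G : Type*} [AddCommMonoid B] [FunLike G A B] [AddMonoidHomClass G A B] (g : G)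
    {X Y : Obj} (φ : CSeq T X Y → A) (p : CSeq T X Y) :
    g (ins m σ φ p) = ins m σ (fun q => g (φ q)) p := by
  induction p with
  | nil X => simp
  | cons f p ih => rw [ins_cons, ins_cons, map_add, ih, map_cutSum]

lemma ins_eq_zero {X Y : Obj} (φ : CSeq T X Y → A) (h : ∀ q, 1 ≤ q.length → φ q = 0)
    (p : CSeq T X Y) : ins m σ φ p = 0 := by
  induction p with
  | nil X => simp
  | cons f p ih =>
    rw [ins_cons, ih _ fun q _ => h _ (by simp [length])]
    simp only [h _ (show 1 ≤ (cons _ _).length by simp [length]), cutSum_zero, add_zero]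

/-- Insertions of the whole sequence are the only ones seen by a function that vanishes on sequences
with at least two entries. -/
lemma ins_eq_single {X Y : Obj} (φ : CSeq T X Y → A) (h : ∀ q, 2 ≤ q.length → φ q = 0)
    (p : CSeq T X Y) (hp : 1 ≤ p.length) : ins m σ φ p = φ (single (m p)) := by
  cases p with
  | nil X => simp [length] at hp
  | cons f p =>
    rw [ins_cons, ins_eq_zero _ _ _ fun q hq => h _ (by simpa [length] using hq), add_zero]
    clear hp
    -- The induction moves entries of `p` into the argument of `m`, so `m (cons f ·)` has to be
    -- replaced by an arbitrary function `G` of the remaining sequence.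
    suffices H : ∀ {W Y Z : Obj} (p : CSeq T Y Z) (φ : CSeq T W Z → A),
        (∀ q, 2 ≤ q.length → φ q = 0) → ∀ G : ∀ {Z : Obj}, CSeq T Y Z → T W Z,
        cutSum (fun _ b e => φ (cons (G b) e)) p = φ (single (G p)) by
      exact H p φ h (fun b => m (cons f b))
    intro W Y Z p
    induction p with
    | nil X => intro φ _ G; rw [cutSum_nil]; rfl
    | cons f p ih =>
      intro φ h G
      rw [cutSum_cons, h _ (by simp [length]), zero_add]
      exact ih φ h (fun b => G (cons f b))

/-- A cut of a sequence with an inserted operation is either before or after the insertion. -/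
lemma ins_cutSum {X Z : Obj} (ψ : ∀ Y, CSeq T X Y → CSeq T Y Z → A) (p : CSeq T X Z) :
    ins m σ (cutSum ψ) p = cutSum (fun Y l r => ins m σ (fun a => ψ Y a r) l +
      ins m σ (fun b => ψ Y (l.map id σ) b) r) p := by
  induction p with
  | nil X => simp
  | cons f p ih =>
    have h1 : ∀ {X Y Z : Obj} (f : T X Y) (p : CSeq T Y Z),
      (cons f p).map id σ = cons (σ f) (p.map id σ) := fun _ _ => rfl
    have h2 : ∀ X : Obj, (nil X : CSeq T X X).map id σ = nil X := fun _ => rfl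
    rw [ins_cons]
    simp only [cutSum_cons, ins_add, ih, cutSum_add, ins_nil, ins_cons, h1, h2, cutSum_cutSum]
    abel

lemma ins_map {Obj' : Type w'} {T' : Obj' → Obj' → Type w} (F : Obj → Obj')
    (τ : ∀ {X Y : Obj}, T X Y → T' (F X) (F Y)) (m' : ∀ {X Y : Obj'}, CSeq T' X Y → T' X Y)
    (σ' : ∀ {X Y : Obj'}, T' X Y → T' X Y)
    (hm : ∀ {X Y : Obj} (p : CSeq T X Y), m' (p.map F τ) = τ (m p))
    (hσ : ∀ {X Y : Obj} (f : T X Y), σ' (τ f) = τ (σ f)) {X Y : Obj}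
    (φ : CSeq T' (F X) (F Y) → A) (p : CSeq T X Y) :
    ins m' σ' φ (p.map F τ) = ins m σ (fun q => φ (q.map F τ)) p := by
  induction p with
  | nil X => simp [map]
  | cons f p ih =>
    simp only [map, ins_cons, cutSum_map, ih, hσ]
    congr 2
    funext Y a b
    rw [← hm]
    rfl

/-- `Homog S p s`: each entry of `p` lies in some `S X Y n`, and these degrees `n` add up to `s`. -/
inductive Homog (S : ∀ X Y : Obj, ℤ → Set (T X Y)) : ∀ {X Y : Obj}, CSeq T X Y → ℤ → Prop
  | nil (X : Obj) : Homog S (CSeq.nil X) 0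
  | cons {X Y Z : Obj} {f : T X Y} {p : CSeq T Y Z} {a s : ℤ} (hf : f ∈ S X Y a)
      (hp : Homog S p s) : Homog S (CSeq.cons f p) (a + s)

lemma Homog.of_mem_cuts {S : ∀ X Y : Obj, ℤ → Set (T X Y)} {X Z : Obj} {p : CSeq T X Z} {s : ℤ}
    (h : Homog S p s) :
    ∀ c ∈ p.cuts, ∃ a b : ℤ, Homog S c.2.1 a ∧ Homog S c.2.2 b ∧ a + b = s := by
  induction h with
  | nil X =>
    intro c hc
    simp only [CSeq.cuts, List.mem_singleton] at hc
    subst hc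
    exact ⟨0, 0, .nil X, .nil X, rfl⟩
  | @cons X Y Z f p a s hf hp ih =>
    intro c hc
    simp only [CSeq.cuts, List.mem_cons, List.mem_map] at hc
    rcases hc with rfl | ⟨d, hd, rfl⟩
    · exact ⟨0, a + s, .nil X, .cons hf hp, zero_add _⟩
    · obtain ⟨a', b', ha', hb', rfl⟩ := ih d hd
      exact ⟨a + a', b', .cons hf ha', hb', add_assoc _ _ _⟩

end CSeq

/-! ### Insertion sums in A-infinity categories -/

namespace AInfData

variable {k : Type u} [CommRing k] (C : AInfData.{u, v, w} k)

lemma insertSum_eq_ins {U : C.Obj → C.Obj → Type w'} [∀ X Y, AddCommGroup (U X Y)]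
    (φ : ∀ {X Y : C.Obj}, CSeq C.Tot X Y → U X Y) {X Y : C.Obj} (p : CSeq C.Tot X Y) :
    C.insertSum (U := U) φ p =
      CSeq.ins C.m (fun {X Y} f => -signMap k (C.Hom X Y) f) (fun q => φ q) p := rfl

lemma HomogSeq.homog {C : AInfData.{u, v, w} k} {X Y : C.Obj} {p : CSeq C.Tot X Y} {s : ℤ}
    (h : C.HomogSeq p s) : CSeq.Homog (fun X Y n => (homogeneous k (C.Hom X Y) n : Set _)) p s := by
  induction h with
  | nil X => exact .nil X
  | cons hf hp ih => exact .cons hf ih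

end AInfData

/-! ### Signs on graded modules -/

section Sign

variable {k : Type u} [CommRing k] {M : ℤ → Type w} [∀ n, AddCommGroup (M n)] [∀ n, Module k (M n)]

@[simp] lemma signMap_lof (n : ℤ) (x : M n) :
    signMap k M (lof k ℤ M n x) = (n.negOnePow : ℤ) • lof k ℤ M n x := by
  simp [signMap]

lemma signMap_signMap (x : ⨁ n, M n) : signMap k M (signMap k M x) = x := by
  suffices h : signMap k M ∘ₗ signMap k M = LinearMap.id from LinearMap.congr_fun h x
  refine DirectSum.linearMap_ext _ fun n => LinearMap.ext fun x => ?_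
  simp only [LinearMap.comp_apply, signMap_lof, map_zsmul, LinearMap.id_apply, smul_smul,
    Int.units_coe_mul_self, one_smul]

lemma lof_mem_homogeneous {n m : ℤ} (h : n = m) (x : M n) :
    lof k ℤ M n x ∈ homogeneous k M m := by
  subst h; exact ⟨x, rfl⟩

end Sign

/-! ### A dg category with A-infinity signs -/

section DgTotal

open CochainComplex.HomComplex

variable {k : Type u} [CommRing k] {𝒞 : Type v} [Category.{w} 𝒞] [Preadditive 𝒞] [Linear k 𝒞]
  {K L M N : CochainComplex 𝒞 ℤ}

lemma signedComp_lof {a b c : ℤ} (h : a + b = c) (g : Cochain L M b) (f : Cochain K L a) :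
    signedComp k K L M (lof k ℤ (Cochain L M) b g) (lof k ℤ (Cochain K L) a f) =
      (a.negOnePow : ℤ) • lof k ℤ (Cochain K M) c (f.comp g h) := by
  subst h
  simp [signedComp]

variable (k K L) in
/-- `f ↦ (-1) ^ |f| d f` on total morphism modules. -/
def dTot : (⨁ n, Cochain K L n) →ₗ[k] ⨁ n, Cochain K L n :=
  DirectSum.toModule k ℤ _ (fun n =>
    (n.negOnePow : ℤ) • (DirectSum.lof k ℤ (Cochain K L) (n + 1) ∘ₗ δ_hom k K L n (n + 1)))

lemma dTot_lof {n m : ℤ} (h : n + 1 = m) (f : Cochain K L n) :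
    dTot k K L (lof k ℤ (Cochain K L) n f) =
      (n.negOnePow : ℤ) • lof k ℤ (Cochain K L) m (δ n m f) := by
  subst h
  simp [dTot]

/-- The Leibniz rule, in the form of the A-infinity relation on two inputs for m_1 = `dTot` and m_2
= `signedComp`. -/
lemma dTot_signedComp (g : ⨁ n, Cochain L M n) (f : ⨁ n, Cochain K L n) :
    dTot k K M (signedComp k K L M g f) = -(signedComp k K L M g (dTot k K L f) +
      signedComp k K L M (dTot k L M g) (-signMap k (Cochain K L) f)) := by
  induction g using DirectSum.induction_on with
  | zero => simp
  | add x y hx hy => simp only [map_add, LinearMap.add_apply, hx, hy]; abel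
  | of b g =>
  induction f using DirectSum.induction_on with
  | zero => simp
  | add x y hx hy => simp only [map_add, hx, hy, neg_add_rev]; abel
  | of a f =>
  change dTot k K M (signedComp k K L M (lof k ℤ (Cochain L M) b g) (lof k ℤ (Cochain K L) a f)) =
    -(signedComp k K L M (lof k ℤ (Cochain L M) b g) (dTot k K L (lof k ℤ (Cochain K L) a f)) +
      signedComp k K L M (dTot k L M (lof k ℤ (Cochain L M) b g))
        (-signMap k (Cochain K L) (lof k ℤ (Cochain K L) a f)))
  rw [signedComp_lof rfl, map_zsmul, dTot_lof rfl, dTot_lof rfl, dTot_lof rfl,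
    δ_comp f g rfl (a + 1) (b + 1) (a + b + 1) rfl rfl rfl, map_zsmul, signedComp_lof
    (show a + 1 + b = a + b + 1 by ring), signMap_lof, ← neg_smul, map_zsmul,
    map_zsmul, LinearMap.smul_apply, signedComp_lof (show a + (b + 1) = a + b + 1 by ring), map_add,
    Units.smul_def, map_zsmul]
  simp only [smul_add, smul_smul, Int.negOnePow_add, Int.negOnePow_one, Units.val_mul,
    Units.val_neg, Units.val_one]
  have ha := Int.units_coe_mul_self a.negOnePow
  have hb := Int.units_coe_mul_self b.negOnePow
  generalize (a.negOnePow : ℤ) = s at *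
  generalize (b.negOnePow : ℤ) = t at *
  generalize lof k ℤ (Cochain K M) (a + b + 1) _ = x
  generalize lof k ℤ (Cochain K M) (a + b + 1) _ = y
  rw [show s * (s * t) = t by rw [← mul_assoc, ha, one_mul],
    show s * (s * t * t) = 1 by rw [mul_assoc s t t, hb, mul_one, ha],
    show s * (s * -1) = -1 by rw [← mul_assoc, ha, one_mul],
    show -s * (t * s) = -t by rw [neg_mul, mul_comm t, ← mul_assoc, ha, one_mul]]
  module

/-- Associativity of composition, in the form of the A-infinity relation on three inputs with m_3 =
0. -/
lemma signedComp_assoc (h : ⨁ n, Cochain M N n) (g : ⨁ n, Cochain L M n)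
    (f : ⨁ n, Cochain K L n) :
    signedComp k K M N h (signedComp k K L M g f) +
      signedComp k K L N (signedComp k L M N h g) (-signMap k (Cochain K L) f) = 0 := by
  induction h using DirectSum.induction_on with
  | zero => simp
  | add x y hx hy =>
    simp only [map_add, LinearMap.add_apply]
    rw [add_add_add_comm, hx, hy, add_zero]
  | of c h =>
  induction g using DirectSum.induction_on with
  | zero => simp
  | add x y hx hy =>
    simp only [map_add, LinearMap.add_apply]
    rw [add_add_add_comm, hx, hy, add_zero]
  | of b g =>
  induction f using DirectSum.induction_on with
  | zero => simp
  | add x y hx hy =>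
    simp only [map_add, neg_add]
    rw [add_add_add_comm, hx, hy, add_zero]
  | of a f =>
  change signedComp k K M N (lof k ℤ (Cochain M N) c h) (signedComp k K L M
      (lof k ℤ (Cochain L M) b g) (lof k ℤ (Cochain K L) a f)) +
    signedComp k K L N (signedComp k L M N (lof k ℤ (Cochain M N) c h)
      (lof k ℤ (Cochain L M) b g)) (-signMap k (Cochain K L) (lof k ℤ (Cochain K L) a f)) = 0
  rw [signedComp_lof rfl, signedComp_lof rfl, map_zsmul, signedComp_lof rfl, signMap_lof,
    ← neg_smul, map_zsmul, map_zsmul, LinearMap.smul_apply,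
    signedComp_lof (add_assoc a b c).symm, Cochain.comp_assoc f g h rfl rfl rfl]
  simp only [smul_smul, Int.negOnePow_add, Units.val_mul]
  rw [← add_smul, show ((a.negOnePow : ℤ) * (a.negOnePow * b.negOnePow) +
    -(a.negOnePow : ℤ) * (b.negOnePow * a.negOnePow)) = 0 by ring, zero_smul]

lemma signMap_signedComp (g : ⨁ n, Cochain L M n) (f : ⨁ n, Cochain K L n) :
    signMap k (Cochain K M) (signedComp k K L M g f) =
      signedComp k K L M (signMap k (Cochain L M) g) (signMap k (Cochain K L) f) := by
  induction g using DirectSum.induction_on with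
  | zero => simp
  | add x y hx hy => simp only [map_add, LinearMap.add_apply, hx, hy]
  | of b g =>
  induction f using DirectSum.induction_on with
  | zero => simp
  | add x y hx hy => simp only [map_add, hx, hy]
  | of a f =>
  change signMap k (Cochain K M) (signedComp k K L M (lof k ℤ (Cochain L M) b g)
      (lof k ℤ (Cochain K L) a f)) = signedComp k K L M (signMap k (Cochain L M)
      (lof k ℤ (Cochain L M) b g)) (signMap k (Cochain K L) (lof k ℤ (Cochain K L) a f))
  rw [signMap_lof, signMap_lof, map_zsmul, map_zsmul, LinearMap.smul_apply, signedComp_lof rfl,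
    map_zsmul, signMap_lof]
  simp only [smul_smul, Int.negOnePow_add, Units.val_mul]
  congr 1
  ring

lemma signedComp_mem_homogeneous {a b c : ℤ} (h : a + b = c) {g : ⨁ n, Cochain L M n}
    {f : ⨁ n, Cochain K L n} (hg : g ∈ homogeneous k (Cochain L M) b)
    (hf : f ∈ homogeneous k (Cochain K L) a) :
    signedComp k K L M g f ∈ homogeneous k (Cochain K M) c := by
  obtain ⟨g, rfl⟩ := hg
  obtain ⟨f, rfl⟩ := hf
  rw [signedComp_lof h]
  exact zsmul_mem (lof_mem_homogeneous rfl _) _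

lemma signedComp_id (g : ⨁ n, Cochain K L n) :
    signedComp k K K L g (lof k ℤ (Cochain K K) 0 (Cochain.ofHom (𝟙 K))) = g := by
  induction g using DirectSum.induction_on with
  | zero => simp
  | add x y hx hy => simp only [map_add, LinearMap.add_apply, hx, hy]
  | of b g =>
  change signedComp k K K L (lof k ℤ (Cochain K L) b g) _ = lof k ℤ (Cochain K L) b g
  rw [signedComp_lof (zero_add b), Cochain.id_comp]
  simp

lemma id_signedComp (f : ⨁ n, Cochain K L n) :
    signedComp k K L L (lof k ℤ (Cochain L L) 0 (Cochain.ofHom (𝟙 L))) f =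
      signMap k (Cochain K L) f := by
  induction f using DirectSum.induction_on with
  | zero => simp
  | add x y hx hy => simp only [map_add, hx, hy]
  | of a f =>
  change signedComp k K L L _ (lof k ℤ (Cochain K L) a f) = signMap k _ (lof k ℤ (Cochain K L) a f)
  rw [signedComp_lof (add_zero a), Cochain.comp_id, signMap_lof]

end DgTotal

/-! ### Contraction identities on total morphism modules -/

namespace Contraction

open CochainComplex.HomComplex

variable {k : Type u} [CommRing k] {𝒞 : Type v} [Category.{w} 𝒞] [Preadditive 𝒞] [Linear k 𝒞]
  {ι : Type w'} {K : ι → CochainComplex 𝒞 ℤ} (c : Contraction k K) {X Y : ι}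

lemma iTot_lof (n : ℤ) (x : HomCohomology k (K X) (K Y) n) :
    c.iTot X Y (lof k ℤ _ n x) = lof k ℤ (Cochain (K X) (K Y)) n (c.i X Y n x) := by
  simp [iTot]

lemma pTot_lof (n : ℤ) (x : Cochain (K X) (K Y) n) :
    c.pTot X Y (lof k ℤ _ n x) = lof k ℤ (HomCohomology k (K X) (K Y)) n (c.p X Y n x) := by
  simp [pTot]

lemma hTot_lof {n m : ℤ} (h : m + 1 = n) (x : Cochain (K X) (K Y) n) :
    c.hTot X Y (lof k ℤ _ n x) =
      (n.negOnePow : ℤ) • lof k ℤ (Cochain (K X) (K Y)) m (c.H X Y n m x) := by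
  obtain rfl : m = n - 1 := by omega
  simp [hTot]

/-- This side condition follows from the others. The homotopy identity at Hx gives Hx - ipHx = HdHx;
applying H to the identity at x gives HdHx = Hx. So ipHx = 0, and pi = 1. -/
lemma p_H {n m : ℤ} (h : m + 1 = n) (x : Cochain (K X) (K Y) n) :
    c.p X Y m (c.H X Y n m x) = 0 := by
  have h1 := c.homotopy X Y (m - 1) m n (by omega) h (c.H X Y n m x)
  rw [c.H_H X Y (m - 1) m n (by omega) h, δ_zero, zero_add] at h1
  have h2 := congrArg (c.H X Y n m) (c.homotopy X Y m n (n + 1) h rfl x)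
  rw [map_sub, c.H_i X Y m n h, map_add, c.H_H X Y m n (n + 1) h rfl, sub_zero, add_zero] at h2
  rw [← h2, sub_eq_self] at h1
  have h3 := c.p_i X Y m (c.p X Y m (c.H X Y n m x))
  rw [h1, map_zero] at h3
  exact h3.symm

lemma hTot_iTot (x : ⨁ n, HomCohomology k (K X) (K Y) n) : c.hTot X Y (c.iTot X Y x) = 0 := by
  induction x using DirectSum.induction_on with
  | zero => simp
  | add x y hx hy => simp only [map_add, hx, hy, add_zero]
  | of n x =>
  change c.hTot X Y (c.iTot X Y (lof k ℤ _ n x)) = 0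
  rw [iTot_lof, hTot_lof _ (sub_add_cancel n 1), c.H_i X Y _ _ (sub_add_cancel n 1), map_zero,
    smul_zero]

lemma hTot_hTot (x : ⨁ n, Cochain (K X) (K Y) n) : c.hTot X Y (c.hTot X Y x) = 0 := by
  induction x using DirectSum.induction_on with
  | zero => simp
  | add x y hx hy => simp only [map_add, hx, hy, add_zero]
  | of n x =>
  change c.hTot X Y (c.hTot X Y (lof k ℤ _ n x)) = 0
  rw [hTot_lof _ (sub_add_cancel n 1), map_zsmul, hTot_lof _ (sub_add_cancel (n - 1) 1),
    c.H_H X Y _ _ _ (sub_add_cancel (n - 1) 1) (sub_add_cancel n 1), map_zero, smul_zero,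
    smul_zero]

lemma pTot_hTot (x : ⨁ n, Cochain (K X) (K Y) n) : c.pTot X Y (c.hTot X Y x) = 0 := by
  induction x using DirectSum.induction_on with
  | zero => simp
  | add x y hx hy => simp only [map_add, hx, hy, add_zero]
  | of n x =>
  change c.pTot X Y (c.hTot X Y (lof k ℤ _ n x)) = 0
  rw [hTot_lof _ (sub_add_cancel n 1), map_zsmul, pTot_lof, p_H _ (sub_add_cancel n 1), map_zero,
    smul_zero]

lemma pTot_dTot (x : ⨁ n, Cochain (K X) (K Y) n) :
    c.pTot X Y (dTot k (K X) (K Y) x) = 0 := by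
  induction x using DirectSum.induction_on with
  | zero => simp
  | add x y hx hy => simp only [map_add, hx, hy, add_zero]
  | of n x =>
  change c.pTot X Y (dTot k (K X) (K Y) (lof k ℤ _ n x)) = 0
  rw [dTot_lof rfl, map_zsmul, pTot_lof, c.p_δ X Y n _ rfl, map_zero, smul_zero]

lemma pTot_iTot (x : ⨁ n, HomCohomology k (K X) (K Y) n) : c.pTot X Y (c.iTot X Y x) = x := by
  induction x using DirectSum.induction_on with
  | zero => simp
  | add x y hx hy => simp only [map_add, hx, hy]
  | of n x =>
  change c.pTot X Y (c.iTot X Y (lof k ℤ _ n x)) = lof k ℤ _ n x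
  rw [iTot_lof, pTot_lof, c.p_i X Y n]

lemma dTot_iTot (x : ⨁ n, HomCohomology k (K X) (K Y) n) :
    dTot k (K X) (K Y) (c.iTot X Y x) = 0 := by
  induction x using DirectSum.induction_on with
  | zero => simp
  | add x y hx hy => simp only [map_add, hx, hy, add_zero]
  | of n x =>
  change dTot k (K X) (K Y) (c.iTot X Y (lof k ℤ _ n x)) = 0
  rw [iTot_lof, dTot_lof rfl, show δ n (n + 1) (c.i X Y n x).1 = 0 from (c.i X Y n x).2, map_zero,
    smul_zero]

/-- The signs in `dTot` and `hTot` belong to degrees that differ by one, so each composite of the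
two is minus the unsigned composite. -/
lemma dTot_hTot (x : ⨁ n, Cochain (K X) (K Y) n) :
    dTot k (K X) (K Y) (c.hTot X Y x) =
      c.iTot X Y (c.pTot X Y x) - x - c.hTot X Y (dTot k (K X) (K Y) x) := by
  induction x using DirectSum.induction_on with
  | zero => simp
  | add x y hx hy => simp only [map_add, hx, hy]; abel
  | of n x =>
  change dTot k (K X) (K Y) (c.hTot X Y (lof k ℤ _ n x)) =
      c.iTot X Y (c.pTot X Y (lof k ℤ _ n x)) - lof k ℤ _ n x -
        c.hTot X Y (dTot k (K X) (K Y) (lof k ℤ _ n x))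
  have h := c.homotopy X Y (n - 1) n (n + 1) (sub_add_cancel n 1) rfl x
  rw [hTot_lof _ (sub_add_cancel n 1), map_zsmul, dTot_lof (sub_add_cancel n 1), dTot_lof rfl,
    map_zsmul, hTot_lof _ rfl, pTot_lof, iTot_lof, ← neg_sub (lof k ℤ _ n x), ← map_sub, h, map_add,
    smul_smul, smul_smul, Int.negOnePow_sub, Int.negOnePow_succ]
  simp only [Int.negOnePow_one, Units.val_neg, mul_neg, neg_smul,
    mul_one, Int.units_coe_mul_self, one_smul]
  abel

lemma signMap_iTot (x : ⨁ n, HomCohomology k (K X) (K Y) n) :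
    c.iTot X Y (signMap k _ x) = signMap k _ (c.iTot X Y x) := by
  induction x using DirectSum.induction_on with
  | zero => simp
  | add x y hx hy => simp only [map_add, hx, hy]
  | of n x =>
  change c.iTot X Y (signMap k _ (lof k ℤ _ n x)) = signMap k _ (c.iTot X Y (lof k ℤ _ n x))
  rw [signMap_lof, map_zsmul, iTot_lof, signMap_lof]

lemma signMap_pTot (x : ⨁ n, Cochain (K X) (K Y) n) :
    c.pTot X Y (signMap k _ x) = signMap k _ (c.pTot X Y x) := by
  induction x using DirectSum.induction_on with
  | zero => simp
  | add x y hx hy => simp only [map_add, hx, hy]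
  | of n x =>
  change c.pTot X Y (signMap k _ (lof k ℤ _ n x)) = signMap k _ (c.pTot X Y (lof k ℤ _ n x))
  rw [signMap_lof, map_zsmul, pTot_lof, signMap_lof]

/-- The homotopy has odd degree. -/
lemma signMap_hTot (x : ⨁ n, Cochain (K X) (K Y) n) :
    c.hTot X Y (signMap k _ x) = -signMap k _ (c.hTot X Y x) := by
  induction x using DirectSum.induction_on with
  | zero => simp
  | add x y hx hy => simp only [map_add, hx, hy]; abel
  | of n x =>
  change c.hTot X Y (signMap k _ (lof k ℤ _ n x)) = -signMap k _ (c.hTot X Y (lof k ℤ _ n x))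
  rw [signMap_lof, map_zsmul, hTot_lof _ (sub_add_cancel n 1), map_zsmul, signMap_lof,
    Int.negOnePow_sub]
  simp only [Int.negOnePow_one, Units.val_neg, mul_neg, neg_smul,
    mul_one, smul_neg, neg_neg]

lemma iTot_mem_homogeneous {n : ℤ} {x : ⨁ n, HomCohomology k (K X) (K Y) n}
    (hx : x ∈ homogeneous k (HomCohomology k (K X) (K Y)) n) :
    c.iTot X Y x ∈ homogeneous k (Cochain (K X) (K Y)) n := by
  obtain ⟨x, rfl⟩ := hx
  rw [iTot_lof]
  exact lof_mem_homogeneous rfl _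

lemma pTot_mem_homogeneous {n : ℤ} {x : ⨁ n, Cochain (K X) (K Y) n}
    (hx : x ∈ homogeneous k (Cochain (K X) (K Y)) n) :
    c.pTot X Y x ∈ homogeneous k (HomCohomology k (K X) (K Y)) n := by
  obtain ⟨x, rfl⟩ := hx
  rw [pTot_lof]
  exact lof_mem_homogeneous rfl _

lemma hTot_mem_homogeneous {n m : ℤ} (h : m + 1 = n) {x : ⨁ n, Cochain (K X) (K Y) n}
    (hx : x ∈ homogeneous k (Cochain (K X) (K Y)) n) :
    c.hTot X Y x ∈ homogeneous k (Cochain (K X) (K Y)) m := by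
  obtain ⟨x, rfl⟩ := hx
  rw [hTot_lof _ h]
  exact zsmul_mem (lof_mem_homogeneous rfl _) _

end Contraction

/-! ### Sums over trees and their recursion -/

namespace Contraction

open CochainComplex.HomComplex CSeq

variable {k : Type u} [CommRing k] {𝒞 : Type v} [Category.{w} 𝒞] [Preadditive 𝒞] [Linear k 𝒞]
  {ι : Type w'} {K : ι → CochainComplex 𝒞 ℤ} (c : Contraction k K)

variable (k K) in
/-- Composable sequences of cohomology classes. -/
abbrev CohSeq := CSeq (fun X Y => ⨁ n, HomCohomology k (K X) (K Y) n)

/-- The value of `i` on a sequence with one entry, zero on all other sequences. -/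
def leafSum {X Y : ι} : CohSeq k K X Y →
    ⨁ n, Cochain (K X) (K Y) n
  | CSeq.nil _ => 0
  | CSeq.cons (X := X) (Y := Y) f (CSeq.nil _) => c.iTot X Y f
  | CSeq.cons _ (CSeq.cons _ _) => 0

/-- The sum of the edge values of all trees of bounded height on a sequence. -/
def edgeSum (n : ℕ) {X Y : ι} (p : CohSeq k K X Y) :
    ⨁ n, Cochain (K X) (K Y) n :=
  ((treesAux n p).map c.edgeValue).sum

/-- The sum of the values at the lowest branch point of all trees of bounded height. -/
def branchSum (n : ℕ) {X Z : ι} (p : CohSeq k K X Z) :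
    ⨁ n, Cochain (K X) (K Z) n :=
  cutSum (fun Y a b => signedComp k (K X) (K Y) (K Z) (c.edgeSum n b) (c.edgeSum n a)) p

@[simp] lemma edgeSum_zero {X Y : ι} (p : CohSeq k K X Y) : c.edgeSum 0 p = 0 := rfl

/-- Sums over nodes whose two branches run over lists of trees. -/
lemma sum_map_node {A : Type*} [AddCommGroup A] [Module k A] {X Z : ι}
    (g : (⨁ n, Cochain (K X) (K Z) n) →ₗ[k] A)
    (φ : BTree (fun X Y => ⨁ n, HomCohomology k (K X) (K Y) n) X Z → A)
    (hφ : ∀ {Y} (l : BTree (fun X Y => ⨁ n, HomCohomology k (K X) (K Y) n) X Y)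
      (r : BTree (fun X Y => ⨁ n, HomCohomology k (K X) (K Y) n) Y Z), φ (BTree.node l r) =
        g (signedComp k (K X) (K Y) (K Z) (c.edgeValue r) (c.edgeValue l)))
    (n : ℕ) (p : CohSeq k K X Z) :
    ((p.cuts.flatMap (fun c => (treesAux n c.2.1).flatMap (fun l =>
      (treesAux n c.2.2).map (fun r => BTree.node l r)))).map φ).sum = g (c.branchSum n p) := by
  have key : ∀ {α : Type (max w w')} (l : List α) (F : α → List A),
      (l.flatMap F).sum = (l.map fun x => (F x).sum).sum := by
    intro α l F
    induction l with
    | nil => simp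
    | cons a l ih => simp [ih]
  rw [branchSum, map_cutSum, cutSum, List.map_flatMap, key]
  congr 1
  refine List.map_congr_left fun e _ => ?_
  rw [List.map_flatMap, key, edgeSum, edgeSum, map_list_sum, map_list_sum, List.map_map,
    List.map_map]
  congr 1
  refine List.map_congr_left fun l _ => ?_
  simp only [List.map_map, Function.comp_apply, ← LinearMap.flip_apply (signedComp k _ _ _)]
  rw [map_list_sum, map_list_sum, List.map_map, List.map_map]
  congr 1
  exact List.map_congr_left fun r _ => hφ l r

/-- A tree is a leaf or a node with two smaller trees. From here on this recursion replaces the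
enumeration of trees. -/
lemma edgeSum_succ (n : ℕ) {X Y : ι} (p : CohSeq k K X Y) :
    c.edgeSum (n + 1) p = c.leafSum p + c.hTot X Y (c.branchSum n p) := by
  rw [edgeSum, treesAux, List.map_append, List.sum_append,
    c.sum_map_node (c.hTot X Y) _ (fun _ _ => rfl)]
  congr 1
  rcases p with _ | ⟨f, _ | ⟨g, p⟩⟩ <;> simp [leafTree, leafSum, edgeValue]

lemma rootSum_succ (n : ℕ) {X Y : ι} (p : CohSeq k K X Y) :
    ((treesAux (n + 1) p).map c.rootValue).sum = c.pTot X Y (c.branchSum n p) := by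
  rw [treesAux, List.map_append, List.sum_append,
    c.sum_map_node (c.pTot X Y) c.rootValue (fun _ _ => rfl)]
  rcases p with _ | ⟨f, _ | ⟨g, p⟩⟩ <;> simp [leafTree, rootValue]

lemma edgeSum_nil (n : ℕ) (X : ι) : c.edgeSum n (nil X) = 0 := by
  induction n with
  | zero => rfl
  | succ n ih => rw [edgeSum_succ, branchSum, cutSum_nil, ih]; simp [leafSum]

lemma edgeSum_of_length_eq_zero (n : ℕ) {X Y : ι} (p : CohSeq k K X Y) (h : p.length = 0) :
    c.edgeSum n p = 0 := by
  cases p with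
  | nil X => exact c.edgeSum_nil n X
  | cons f p => simp [length] at h

lemma edgeSum_single (n : ℕ) {X Y : ι} (f : ⨁ n, HomCohomology k (K X) (K Y) n) :
    c.edgeSum (n + 1) (cons f (nil Y)) = c.iTot X Y f := by
  rw [edgeSum_succ, branchSum, cutSum_cons, cutSum_nil, edgeSum_nil, edgeSum_nil]
  simp [leafSum]

/-- Edge sums vanish on empty sequences, so only cuts into two strictly shorter pieces contribute.
-/
lemma branchSum_congr (n m : ℕ) {X Y : ι} (p : CohSeq k K X Y)
    (h : ∀ {X Y : ι} (q : CohSeq k K X Y),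
      q.length < p.length → c.edgeSum n q = c.edgeSum m q) :
    c.branchSum n p = c.branchSum m p := by
  refine cutSum_congr p fun Y a b hab => ?_
  rcases Nat.eq_zero_or_pos a.length with ha | ha
  · simp [c.edgeSum_of_length_eq_zero _ a ha]
  rcases Nat.eq_zero_or_pos b.length with hb | hb
  · simp [c.edgeSum_of_length_eq_zero _ b hb]
  rw [h a (by omega), h b (by omega)]

/-- Makes the height bound irrelevant once it reaches the number of leaves. -/
lemma edgeSum_stable (n : ℕ) {X Y : ι} (p : CohSeq k K X Y) (hp : p.length ≤ n) :
    c.edgeSum n p = c.edgeSum p.length p := by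
  have key : ∀ (n : ℕ) {X Y : ι} (p : CohSeq k K X Y),
      p.length ≤ n → c.edgeSum (n + 1) p = c.edgeSum n p := by
    intro n
    induction n with
    | zero =>
      intro X Y p hp
      rw [c.edgeSum_of_length_eq_zero _ p (by omega), c.edgeSum_of_length_eq_zero _ p (by omega)]
    | succ n ih =>
      intro X Y p hp
      rw [edgeSum_succ, c.edgeSum_succ n, c.branchSum_congr (n + 1) n p]
      exact fun q hq => ih q (by omega)
  induction n, hp using Nat.le_induction with
  | base => rfl
  | succ n hn ih => rw [key n p hn, ih]

lemma branchSum_stable (n m : ℕ) {X Y : ι} (p : CohSeq k K X Y)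
    (hn : p.length ≤ n + 1) (hm : p.length ≤ m + 1) :
    c.branchSum n p = c.branchSum m p :=
  c.branchSum_congr n m p fun q hq => by
    rw [c.edgeSum_stable n q (by omega), c.edgeSum_stable m q (by omega)]

/-- The transferred operations, in terms of the sums at the lowest branch point. -/
lemma sum_rootValue (n : ℕ) {X Y : ι} (p : CohSeq k K X Y) (hn : p.length ≤ n + 1) :
    (p.trees.map c.rootValue).sum = c.pTot X Y (c.branchSum n p) := by
  rw [trees]
  cases h : p.length with
  | zero =>
    cases p with
    | nil X => simp [treesAux, branchSum, edgeSum_nil]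
    | cons f p => simp [length] at h
  | succ m => rw [rootSum_succ, c.branchSum_stable m n p (by omega) hn]

lemma edgeSum_length {X Y : ι} (p : CohSeq k K X Y) :
    c.edgeSum p.length p = c.leafSum p + c.hTot X Y (c.branchSum p.length p) := by
  rw [← c.edgeSum_stable (p.length + 1) p (Nat.le_succ _), edgeSum_succ]

lemma branchSum_length {X Z : ι}
    (p : CohSeq k K X Z) :
    c.branchSum p.length p = cutSum (fun Y a b => signedComp k (K X) (K Y) (K Z)
      (c.edgeSum b.length b) (c.edgeSum a.length a)) p :=
  cutSum_congr p fun Y a b hab => by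
    rw [c.edgeSum_stable _ a (by omega), c.edgeSum_stable _ b (by omega)]

/-! #### Multilinearity, degrees and signs -/

lemma edgeSum_add (n : ℕ) : ∀ {W X Y Z : ι}
    (p : CohSeq k K W X)
    (f g : ⨁ n, HomCohomology k (K X) (K Y) n)
    (q : CohSeq k K Y Z),
    c.edgeSum n (p.append (cons (f + g) q)) =
      c.edgeSum n (p.append (cons f q)) + c.edgeSum n (p.append (cons g q)) ∧
    c.branchSum n (p.append (cons (f + g) q)) =
      c.branchSum n (p.append (cons f q)) + c.branchSum n (p.append (cons g q)) := by
  -- At equal height bound, additivity passes from edge sums to branch sums: the changed entry lies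
  -- in exactly one piece of each cut.
  have key : ∀ n, (∀ {W X Y Z : ι}
    (p : CohSeq k K W X)
    (f g : ⨁ n, HomCohomology k (K X) (K Y) n)
    (q : CohSeq k K Y Z),
    c.edgeSum n (p.append (cons (f + g) q)) =
      c.edgeSum n (p.append (cons f q)) + c.edgeSum n (p.append (cons g q))) →
    ∀ {W X Y Z : ι}
    (p : CohSeq k K W X)
    (f g : ⨁ n, HomCohomology k (K X) (K Y) n)
    (q : CohSeq k K Y Z),
    c.branchSum n (p.append (cons (f + g) q)) =
      c.branchSum n (p.append (cons f q)) + c.branchSum n (p.append (cons g q)) := by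
    intro n ih W X Y Z p f g q
    simp only [branchSum, cutSum_append_cons, ih, map_add, LinearMap.add_apply, cutSum_add]
    abel
  induction n with
  | zero => exact fun p f g q => ⟨by simp, key 0 (by simp) p f g q⟩
  | succ n ih =>
    have h : ∀ {W X Y Z : ι} (p : CohSeq k K W X)
      (f g : ⨁ n, HomCohomology k (K X) (K Y) n)
      (q : CohSeq k K Y Z),
      c.edgeSum (n + 1) (p.append (cons (f + g) q)) =
        c.edgeSum (n + 1) (p.append (cons f q)) + c.edgeSum (n + 1) (p.append (cons g q)) := by
      intro W X Y Z p f g q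
      simp only [edgeSum_succ, (ih p f g q).2, map_add]
      have : c.leafSum (p.append (cons (f + g) q)) =
          c.leafSum (p.append (cons f q)) + c.leafSum (p.append (cons g q)) := by
        rcases p with _ | ⟨f', _ | ⟨f'', p⟩⟩ <;> rcases q with _ | ⟨g', q⟩ <;>
          simp [append, leafSum]
      rw [this]
      abel
    exact @fun W X Y Z p f g q => ⟨h p f g q, key _ h p f g q⟩

lemma edgeSum_smul (n : ℕ) : ∀ {W X Y Z : ι}
    (p : CohSeq k K W X) (a : k)
    (f : ⨁ n, HomCohomology k (K X) (K Y) n)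
    (q : CohSeq k K Y Z),
    c.edgeSum n (p.append (cons (a • f) q)) = a • c.edgeSum n (p.append (cons f q)) ∧
    c.branchSum n (p.append (cons (a • f) q)) = a • c.branchSum n (p.append (cons f q)) := by
  have key : ∀ n, (∀ {W X Y Z : ι}
    (p : CohSeq k K W X) (a : k)
    (f : ⨁ n, HomCohomology k (K X) (K Y) n)
    (q : CohSeq k K Y Z),
    c.edgeSum n (p.append (cons (a • f) q)) = a • c.edgeSum n (p.append (cons f q))) →
    ∀ {W X Y Z : ι}
    (p : CohSeq k K W X) (a : k)
    (f : ⨁ n, HomCohomology k (K X) (K Y) n)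
    (q : CohSeq k K Y Z),
    c.branchSum n (p.append (cons (a • f) q)) = a • c.branchSum n (p.append (cons f q)) := by
    intro n ih W X Y Z p a f q
    simp only [branchSum, cutSum_append_cons, ih, map_smul, LinearMap.smul_apply, smul_add]
    rw [← LinearMap.lsmul_apply, ← LinearMap.lsmul_apply, map_cutSum, map_cutSum]
    rfl
  induction n with
  | zero => exact fun p a f q => ⟨by simp, key 0 (by simp) p a f q⟩
  | succ n ih =>
    have h : ∀ {W X Y Z : ι} (p : CohSeq k K W X)
      (a : k) (f : ⨁ n, HomCohomology k (K X) (K Y) n)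
      (q : CohSeq k K Y Z),
      c.edgeSum (n + 1) (p.append (cons (a • f) q)) =
        a • c.edgeSum (n + 1) (p.append (cons f q)) := by
      intro W X Y Z p a f q
      simp only [edgeSum_succ, (ih p a f q).2, map_smul, smul_add]
      congr 1
      rcases p with _ | ⟨f', _ | ⟨f'', p⟩⟩ <;> rcases q with _ | ⟨g', q⟩ <;>
          simp [append, leafSum]
    exact @fun W X Y Z p a f q => ⟨h p a f q, key _ h p a f q⟩

/-- The operations on cohomology, as a function on sequences. -/
def rootSum {X Y : ι} (p : CohSeq k K X Y) :
    ⨁ n, HomCohomology k (K X) (K Y) n :=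
  c.pTot X Y (c.branchSum p.length p)

/-- The sign `(-1) ^ (|f| - 1)` on cohomology. -/
def cohSign {X Y : ι} (f : ⨁ n, HomCohomology k (K X) (K Y) n) :
    ⨁ n, HomCohomology k (K X) (K Y) n :=
  -signMap k (HomCohomology k (K X) (K Y)) f

/-- The entries are homogeneous and their degrees add up to `s`. -/
abbrev CohHomog {X Y : ι} (p : CohSeq k K X Y) (s : ℤ) : Prop :=
  Homog (fun X Y n => (homogeneous k (HomCohomology k (K X) (K Y)) n : Set _)) p s

lemma leafSum_mem_homogeneous {X Y : ι} (p : CohSeq k K X Y) (s : ℤ)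
    (h : CohHomog p s) :
    c.leafSum p ∈ homogeneous k (Cochain (K X) (K Y)) (s + 1 - p.length) := by
  cases h with
  | nil X => exact zero_mem _
  | @cons _ Y _ f _ a _ hf hp =>
    cases hp with
    | nil X =>
      have : a + 0 + 1 - (((cons f (nil Y) : CohSeq k K _ _).length : ℕ) : ℤ) = a := by
        simp [length]
      rw [this]
      exact c.iTot_mem_homogeneous hf
    | cons hg hp => exact zero_mem _

/-- Composition preserves total degree and each homotopy lowers it by one. A tree with d leaves has
d - 2 internal edges above the root, and one more homotopy in its edge value. -/
lemma edgeSum_mem_homogeneous (n : ℕ) : ∀ {X Y : ι} (p : CohSeq k K X Y) (s : ℤ),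
    CohHomog p s →
    c.edgeSum n p ∈ homogeneous k (Cochain (K X) (K Y)) (s + 1 - p.length) ∧
    c.branchSum n p ∈ homogeneous k (Cochain (K X) (K Y)) (s + 2 - p.length) := by
  have key : ∀ n, (∀ {X Y : ι} (p : CohSeq k K X Y) (s : ℤ), CohHomog p s →
    c.edgeSum n p ∈ homogeneous k (Cochain (K X) (K Y)) (s + 1 - p.length)) →
    ∀ {X Y : ι} (p : CohSeq k K X Y) (s : ℤ), CohHomog p s →
    c.branchSum n p ∈ homogeneous k (Cochain (K X) (K Y)) (s + 2 - p.length) := by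
    intro n ih X Y p s hs
    refine cutSum_mem _ _ p fun e he => ?_
    obtain ⟨a, b, ha, hb, rfl⟩ := hs.of_mem_cuts e he
    refine signedComp_mem_homogeneous ?_ (ih _ _ hb) (ih _ _ ha)
    have := length_of_mem_cuts p e he
    rw [← this]
    push_cast
    ring
  induction n with
  | zero => exact fun p s hs => ⟨zero_mem _, key 0 (fun _ _ _ => zero_mem _) p s hs⟩
  | succ n ih =>
    have h : ∀ {X Y : ι} (p : CohSeq k K X Y) (s : ℤ), CohHomog p s →
        c.edgeSum (n + 1) p ∈ homogeneous k (Cochain (K X) (K Y)) (s + 1 - p.length) := by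
      intro X Y p s hs
      rw [edgeSum_succ]
      exact add_mem (c.leafSum_mem_homogeneous p s hs)
        (c.hTot_mem_homogeneous (by ring) (ih p s hs).2)
    exact @fun X Y p s hs => ⟨h p s hs, key _ h p s hs⟩

/-- On d inputs the edge sum has degree 1 - d, so the shifted degree |f| - 1 of its value is the sum
of the shifted degrees of the inputs. -/
lemma edgeSum_twist (n : ℕ) {X Y : ι} (p : CohSeq k K X Y) :
    c.edgeSum n (X := X) (Y := Y) (p.map id cohSign) =
      -signMap k (Cochain (K X) (K Y)) (c.edgeSum n p) := by
  induction n generalizing X Y with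
  | zero => simp
  | succ n ih =>
    have h : c.branchSum n (X := X) (Z := Y) (p.map id cohSign) =
        signMap k (Cochain (K X) (K Y)) (c.branchSum n p) := by
      rw [show c.branchSum n p = cutSum _ p from rfl, map_cutSum]
      refine (cutSum_map (T' := fun X Y => ⨁ n, HomCohomology k (K X) (K Y) n) id cohSign _ p).trans
        (cutSum_congr p fun V a b _ => ?_)
      rw [signMap_signedComp]
      change signedComp k (K X) (K V) (K Y) (c.edgeSum n (X := V) (Y := Y) (b.map id cohSign))
        (c.edgeSum n (X := X) (Y := V) (a.map id cohSign)) = _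
      rw [ih, ih]
      simp only [map_neg, LinearMap.neg_apply, neg_neg]
    rw [edgeSum_succ, edgeSum_succ, h, signMap_hTot, map_add, neg_add]
    congr 1
    rcases p with _ | ⟨f, _ | ⟨g, p⟩⟩
    · exact (by simp : (0 : ⨁ n, Cochain (K _) (K _) n) = -signMap k _ 0)
    · change c.iTot _ _ (-signMap k _ f) = -signMap k _ (c.iTot _ _ f)
      rw [map_neg, signMap_iTot]
    · exact (by simp : (0 : ⨁ n, Cochain (K _) (K _) n) = -signMap k _ 0)

/-! #### The `A_∞`-relations -/

/-- The sum at the lowest branch point is compatible with the differential. -/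
lemma dTot_branchSum (m : ℕ) : ∀ {X Y : ι} (p : CohSeq k K X Y), p.length ≤ m →
    dTot k (K X) (K Y) (c.branchSum p.length p) =
      -ins c.rootSum cohSign (fun q => c.branchSum q.length q) p := by
  -- From dB = -B∘m to dF = F∘m - B on the same sequence. The term ipB produced by dh is the leaf
  -- part of F∘m, namely i applied to the operation on all of `p`.
  have key : ∀ {X Y : ι} (p : CohSeq k K X Y),
      dTot k (K X) (K Y) (c.branchSum p.length p) =
        -ins c.rootSum cohSign (fun q => c.branchSum q.length q) p →
      dTot k (K X) (K Y) (c.edgeSum p.length p) =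
        ins c.rootSum cohSign (fun q => c.edgeSum q.length q) p - c.branchSum p.length p := by
    intro X Y p hp
    have hl : dTot k (K X) (K Y) (c.leafSum p) = 0 := by
      rcases p with _ | ⟨f, _ | ⟨g, p⟩⟩
      · simp [leafSum]
      · exact c.dTot_iTot _
      · simp [leafSum]
    have hi : ins c.rootSum cohSign (fun q => c.leafSum q) p =
        c.iTot X Y (c.pTot X Y (c.branchSum p.length p)) := by
      cases p with
      | nil X => rw [ins_nil, branchSum, cutSum_nil, edgeSum_nil]; simp
      | cons f p =>
        rw [ins_eq_single _ _ _ _ _ (by simp [length])]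
        · rfl
        · intro q hq
          rcases q with _ | ⟨f, _ | ⟨g, q⟩⟩
          · rfl
          · simp [length] at hq
          · rfl
    rw [edgeSum_length, map_add, hl, zero_add, dTot_hTot, hp, map_neg, map_ins]
    simp only [edgeSum_length, ins_add, hi]
    abel
  induction m with
  | zero =>
    intro X Y p hp
    cases p with
    | nil X => rw [ins_nil, branchSum, cutSum_nil, edgeSum_nil]; simp
    | cons f p => simp [length] at hp
  | succ m ih =>
    intro X Y p hp
    have hF : ∀ {X Y : ι} (q : CohSeq k K X Y), q.length < p.length →
        dTot k (K X) (K Y) (c.edgeSum q.length q) =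
        ins c.rootSum cohSign (fun q => c.edgeSum q.length q) q - c.branchSum q.length q :=
      fun q hq => key q (ih q (by omega))
    -- The induction hypothesis covers only shorter pieces. If `l` is all of `p`, then `r` is empty
    -- and its edge sum is zero.
    have h1 : ∀ W (l : CohSeq k K X W) (r : CohSeq k K W Y),
        l.length + r.length = p.length →
        signedComp k (K X) (K W) (K Y) (c.edgeSum r.length r)
          (dTot k (K X) (K W) (c.edgeSum l.length l)) =
        signedComp k (K X) (K W) (K Y) (c.edgeSum r.length r)
          (ins c.rootSum cohSign (fun q => c.edgeSum q.length q) l - c.branchSum l.length l) := by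
      intro W l r h
      rcases Nat.eq_zero_or_pos r.length with hr | hr
      · simp [c.edgeSum_of_length_eq_zero _ r hr]
      · rw [hF l (by omega)]
    have h2 : ∀ W (l : CohSeq k K X W) (r : CohSeq k K W Y),
        l.length + r.length = p.length →
        signedComp k (K X) (K W) (K Y) (dTot k (K W) (K Y) (c.edgeSum r.length r))
          (-signMap k _ (c.edgeSum l.length l)) =
        signedComp k (K X) (K W) (K Y)
          (ins c.rootSum cohSign (fun q => c.edgeSum q.length q) r - c.branchSum r.length r)
          (-signMap k _ (c.edgeSum l.length l)) := by
      intro W l r h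
      rcases Nat.eq_zero_or_pos l.length with hr | hr
      · simp [c.edgeSum_of_length_eq_zero _ l hr]
      · rw [hF r (by omega)]
    -- Expanding B turns both sums into sums over cuts into three pieces; they cancel by
    -- associativity.
    have hassoc : cutSum (fun W l r =>
        signedComp k (K X) (K W) (K Y) (c.edgeSum r.length r) (c.branchSum l.length l)) p +
        cutSum (fun W l r => signedComp k (K X) (K W) (K Y) (c.branchSum r.length r)
          (-signMap k _ (c.edgeSum l.length l))) p = 0 := by
      simp only [branchSum_length]
      have hr : ∀ W (l : CohSeq k K X W) (r : CohSeq k K W Y),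
          signedComp k (K X) (K W) (K Y) (cutSum (fun V a b => signedComp k (K W) (K V) (K Y)
            (c.edgeSum b.length b) (c.edgeSum a.length a)) r)
            (-signMap k _ (c.edgeSum l.length l)) =
          cutSum (fun V a b => signedComp k (K X) (K W) (K Y) (signedComp k (K W) (K V) (K Y)
            (c.edgeSum b.length b) (c.edgeSum a.length a))
            (-signMap k _ (c.edgeSum l.length l))) r := fun W l r => by
        rw [← LinearMap.flip_apply, map_cutSum]
        rfl
      simp only [hr]
      simp only [map_cutSum]
      rw [cutSum_cutSum, ← cutSum_add]
      refine Eq.trans (cutSum_congr p fun W l r _ => ?_) (cutSum_zero p)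
      rw [← cutSum_add]
      refine Eq.trans (cutSum_congr l fun V a b _ => ?_) (cutSum_zero l)
      exact signedComp_assoc _ _ _
    -- An insertion happens in one of the two pieces. If it is in the later piece `r`, every entry
    -- of `l` acquires a sign, which `edgeSum_twist` moves to the value of F on `l`.
    have hins : ins c.rootSum cohSign (fun q => c.branchSum q.length q) p =
        cutSum (fun W l r => signedComp k (K X) (K W) (K Y) (c.edgeSum r.length r)
          (ins c.rootSum cohSign (fun q => c.edgeSum q.length q) l)) p +
        cutSum (fun W l r => signedComp k (K X) (K W) (K Y)
          (ins c.rootSum cohSign (fun q => c.edgeSum q.length q) r)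
          (-signMap k _ (c.edgeSum l.length l))) p := by
      simp only [branchSum_length]
      refine (ins_cutSum _ _ _ _).trans ?_
      rw [cutSum_add]
      congr 1
      · simp only [map_ins]
      · refine cutSum_congr p fun W l r _ => ?_
        rw [← LinearMap.flip_apply (signedComp k _ _ _), map_ins, ← edgeSum_twist]
        have : (l.map id cohSign : CohSeq k K X W).length = l.length := length_map _ _ _
        simp only [this]
        rfl
    rw [branchSum_length, map_cutSum]
    simp only [dTot_signedComp]
    rw [cutSum_congr p fun W l r h => by rw [h1 W l r h, h2 W l r h]]
    rw [hins]
    have hneg : ∀ ψ : ∀ W, CohSeq k K X W → CohSeq k K W Y →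
        ⨁ n, Cochain (K X) (K Y) n, cutSum (fun W a b => -ψ W a b) p = -cutSum ψ p := fun ψ =>
      (map_cutSum (-AddMonoidHom.id (⨁ n, Cochain (K X) (K Y) n)) ψ p).symm
    rw [hneg, neg_inj]
    simp only [map_sub, LinearMap.sub_apply]
    rw [← sub_eq_zero]
    simp only [sub_eq_add_neg, cutSum_add, hneg]
    rw [← neg_eq_zero.2 hassoc]
    abel

/-- Apply p to dB = -B∘m and use pd = 0. -/
lemma ins_rootSum {X Y : ι} (p : CohSeq k K X Y) :
    ins c.rootSum cohSign (fun q => c.rootSum q) p = 0 := by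
  simp only [rootSum]
  rw [← map_ins, ← neg_neg (ins _ _ _ p)]
  refine (congrArg _ (congrArg _ (c.dTot_branchSum _ p le_rfl).symm)).trans ?_
  rw [map_neg, pTot_dTot, neg_zero]

end Contraction

namespace Contraction

open CochainComplex.HomComplex CSeq

variable {k : Type u} [CommRing k] {𝒞 : Type v} [Category.{w} 𝒞] [Preadditive 𝒞] [Linear k 𝒞]
  {ι : Type w'} {K : ι → CochainComplex 𝒞 ℤ} (c : Contraction k K)

/-! #### Units -/

lemma leafSum_of_two_le {X Y : ι} (p : CohSeq k K X Y) (hp : 2 ≤ p.length) : c.leafSum p = 0 := by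
  rcases p with _ | ⟨f, _ | ⟨g, q⟩⟩
  · rfl
  · simp [length] at hp
  · rfl

/-- Edge values lie in the images of i and H, and Hi = 0, HH = 0. -/
lemma hTot_edgeSum (n : ℕ) {X Y : ι} (p : CohSeq k K X Y) :
    c.hTot X Y (c.edgeSum n p) = 0 := by
  cases n with
  | zero => simp
  | succ n =>
    rw [edgeSum_succ, map_add, hTot_hTot, add_zero]
    rcases p with _ | ⟨f, _ | ⟨g, q⟩⟩
    · exact map_zero _
    · exact c.hTot_iTot f
    · exact map_zero _

lemma pTot_edgeSum (n : ℕ) {X Y : ι} (p : CohSeq k K X Y) (hp : 2 ≤ p.length) :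
    c.pTot X Y (c.edgeSum n p) = 0 := by
  cases n with
  | zero => simp
  | succ n => rw [edgeSum_succ, map_add, pTot_hTot, add_zero, c.leafSum_of_two_le p hp, map_zero]

variable (k K) in
/-- The class of the identity. -/
def cohUnit (X : ι) : ⨁ n, HomCohomology k (K X) (K X) n :=
  lof k ℤ (HomCohomology k (K X) (K X)) 0
    (cohClass k (Cochain.ofHom (𝟙 (K X))) (by simp))

/-- A contraction represents the classes of the identities by the identities. -/
def IsUnital : Prop :=
  ∀ X : ι, (c.i X X 0 (cohClass k (Cochain.ofHom (𝟙 (K X))) (by simp)) : Cochain (K X) (K X) 0) =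
    Cochain.ofHom (𝟙 (K X))

variable {c}

lemma IsUnital.iTot (hc : c.IsUnital) (X : ι) :
    c.iTot X X (cohUnit k K X) = lof k ℤ (Cochain (K X) (K X)) 0 (Cochain.ofHom (𝟙 (K X))) := by
  rw [cohUnit, iTot_lof, hc X]

/-- By `hn` the unit must be alone in its piece, so a single cut survives, and it composes with the
identity. -/
lemma IsUnital.branchSum_cons_unit (hc : c.IsUnital) (n : ℕ)
    (hn : ∀ {W X Y : ι} (p : CohSeq k K W X) (q : CohSeq k K X Y),
      1 ≤ p.length + q.length → c.edgeSum (n + 1) (p.append (cons (cohUnit k K X) q)) = 0)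
    {X Y : ι} (q : CohSeq k K X Y) :
    c.branchSum (n + 1) (cons (cohUnit k K X) q) = c.edgeSum (n + 1) q := by
  rw [branchSum, cutSum_cons, edgeSum_nil, map_zero, zero_add, cutSum_eq_nil_left, edgeSum_single,
    hc.iTot, signedComp_id]
  intro Z a b ha
  rw [show cons (cohUnit k K X) a = (nil X).append (cons (cohUnit k K X) a) from rfl,
    hn _ _ (by simpa [length] using ha), map_zero]

lemma IsUnital.branchSum_append_unit (hc : c.IsUnital) (n : ℕ)
    (hn : ∀ {W X Y : ι} (p : CohSeq k K W X) (q : CohSeq k K X Y),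
      1 ≤ p.length + q.length → c.edgeSum (n + 1) (p.append (cons (cohUnit k K X) q)) = 0)
    {W X : ι} (p : CohSeq k K W X) :
    c.branchSum (n + 1) (p.append (cons (cohUnit k K X) (nil X))) =
      signMap k _ (c.edgeSum (n + 1) p) := by
  rw [branchSum, cutSum_append_cons, cutSum_nil, edgeSum_nil, map_zero, LinearMap.zero_apply,
    add_zero, cutSum_eq_nil_right]
  · change signedComp k _ _ _ (c.edgeSum (n + 1) (cons (cohUnit k K X) (nil X))) _ = _
    rw [edgeSum_single, hc.iTot, id_signedComp]
  · intro Z a b hb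
    rw [hn _ _ (by omega), map_zero, LinearMap.zero_apply]

/-- A unit in the interior always shares its piece with a neighbour. -/
lemma branchSum_unit (n : ℕ)
    (hn : ∀ {W X Y : ι} (p : CohSeq k K W X) (q : CohSeq k K X Y),
      1 ≤ p.length + q.length → c.edgeSum n (p.append (cons (cohUnit k K X) q)) = 0)
    {W X Y : ι} (p : CohSeq k K W X) (q : CohSeq k K X Y) (hp : 1 ≤ p.length) (hq : 1 ≤ q.length) :
    c.branchSum n (p.append (cons (cohUnit k K X) q)) = 0 := by
  have h1 : ∀ Z (b : CohSeq k K Z X), c.edgeSum n (b.append (cons (cohUnit k K X) q)) = 0 :=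
    fun Z b => hn b q (by omega)
  have h2 : ∀ Z (a : CohSeq k K X Z), c.edgeSum n (p.append (cons (cohUnit k K X) a)) = 0 :=
    fun Z a => hn p a (by omega)
  rw [branchSum, cutSum_append_cons]
  simp only [h1, h2, map_zero, LinearMap.zero_apply, cutSum_zero, add_zero]

/-- With a unit at either end the branch sum is an edge sum up to sign, which the homotopy kills;
with an interior unit it is already zero. -/
lemma IsUnital.edgeSum_unit (hc : c.IsUnital) (n : ℕ) : ∀ {W X Y : ι} (p : CohSeq k K W X)
    (q : CohSeq k K X Y), 1 ≤ p.length + q.length →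
    c.edgeSum n (p.append (cons (cohUnit k K X) q)) = 0 := by
  induction n with
  | zero => exact fun p q _ => rfl
  | succ n ih =>
    intro W X Y p q h
    rw [edgeSum_succ, c.leafSum_of_two_le _ (by rw [length_append]; simp only [length]; omega),
      zero_add]
    cases n with
    | zero => simp [branchSum, cutSum_zero]
    | succ n =>
      rcases p with _ | ⟨f, p⟩
      · rw [append, hc.branchSum_cons_unit n ih, hTot_edgeSum]
      · rcases q with _ | ⟨g, q⟩
        · rw [hc.branchSum_append_unit n ih, signMap_hTot, hTot_edgeSum, map_zero, neg_zero]
        · rw [branchSum_unit _ ih _ _ (by simp [length]) (by simp [length]), map_zero]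

lemma IsUnital.rootSum_unit (hc : c.IsUnital) {W X Y : ι} (p : CohSeq k K W X)
    (q : CohSeq k K X Y) (h : p.length + q.length + 1 ≠ 2) :
    c.rootSum (p.append (cons (cohUnit k K X) q)) = 0 := by
  rw [rootSum, length_append, show p.length + (cons (cohUnit k K X) q).length =
    p.length + q.length + 1 by simp only [length]; omega]
  rcases p with _ | ⟨f, p⟩
  · rw [append, hc.branchSum_cons_unit _ (hc.edgeSum_unit _)]
    rcases Nat.lt_or_ge q.length 2 with hq | hq
    -- Length one is excluded by `h`: that is m_2 with a unit, the only case with a nonzero value.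
    · rw [c.edgeSum_of_length_eq_zero _ q (by simp only [length] at h; omega), map_zero]
    · exact c.pTot_edgeSum _ q hq
  · rcases q with _ | ⟨g, q⟩
    · rw [hc.branchSum_append_unit _ (hc.edgeSum_unit _), signMap_pTot, pTot_edgeSum, map_zero]
      simp only [length] at h ⊢
      omega
    · rw [branchSum_unit _ (hc.edgeSum_unit _) _ _ (by simp [length]) (by simp [length]), map_zero]

lemma rootSum_pair {X Y Z : ι} (g : ⨁ n, HomCohomology k (K Y) (K Z) n)
    (f : ⨁ n, HomCohomology k (K X) (K Y) n) :
    c.rootSum (pair g f) =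
      c.pTot X Z (signedComp k (K X) (K Y) (K Z) (c.iTot Y Z g) (c.iTot X Y f)) := by
  rw [rootSum, show (pair g f : CohSeq k K X Z).length = 1 + 1 from rfl, branchSum, pair, single,
    cutSum_cons, cutSum_cons, cutSum_nil, edgeSum_nil, edgeSum_nil, edgeSum_single, edgeSum_single]
  simp

lemma rootSum_single {X Y : ι} (f : ⨁ n, HomCohomology k (K X) (K Y) n) :
    c.rootSum (single f) = 0 := by
  rw [rootSum, branchSum, single, cutSum_cons, cutSum_nil, edgeSum_nil, edgeSum_nil]
  simp

/-- The operations of the transferred structure. -/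
lemma transfer_m {X Y : ι} (p : CohSeq k K X Y) : c.transfer.m p = c.rootSum p :=
  c.sum_rootValue _ p (Nat.le_succ _)

lemma rootSum_add {W X Y Z : ι} (p : CohSeq k K W X) (f g : ⨁ n, HomCohomology k (K X) (K Y) n)
    (q : CohSeq k K Y Z) : c.rootSum (p.append (cons (f + g) q)) =
      c.rootSum (p.append (cons f q)) + c.rootSum (p.append (cons g q)) := by
  simp only [rootSum, length_append, length, (c.edgeSum_add _ p f g q).2, map_add]

lemma rootSum_smul {W X Y Z : ι} (p : CohSeq k K W X) (a : k)
    (f : ⨁ n, HomCohomology k (K X) (K Y) n) (q : CohSeq k K Y Z) :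
    c.rootSum (p.append (cons (a • f) q)) = a • c.rootSum (p.append (cons f q)) := by
  simp only [rootSum, length_append, length, (c.edgeSum_smul _ p a f q).2, map_smul]

lemma IsUnital.rootSum_pair_unit (hc : c.IsUnital) {X Y : ι}
    (f : ⨁ n, HomCohomology k (K X) (K Y) n) : c.rootSum (pair f (cohUnit k K X)) = f := by
  rw [rootSum_pair, hc.iTot, signedComp_id, pTot_iTot]

lemma IsUnital.rootSum_unit_pair (hc : c.IsUnital) {X Y : ι}
    (g : ⨁ n, HomCohomology k (K X) (K Y) n) :
    signMap k _ (c.rootSum (pair (cohUnit k K Y) g)) = g := by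
  rw [rootSum_pair, hc.iTot, id_signedComp, signMap_pTot, pTot_iTot, signMap_signMap]

/-- Homotopy transfer gives a strictly unital `A_∞`-category if the identities represent their own
classes. -/
theorem IsUnital.isAInfCategory (hc : c.IsUnital) : c.transfer.IsAInfCategory := by
  have hm : @AInfData.m _ _ c.transfer = @rootSum _ _ _ _ _ _ _ _ c := by
    funext X Y q
    exact transfer_m q
  refine ⟨fun X => rfl, ⟨?_, ?_⟩, ?_, ?_, ?_, ?_, ?_⟩
  · intro W X Y Z
    rw [hm]
    exact rootSum_add
  · intro W X Y Z
    rw [hm]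
    exact rootSum_smul
  · intro X Y p s hs
    rw [hm]
    exact c.pTot_mem_homogeneous (c.edgeSum_mem_homogeneous (length p) p s hs.homog).2
  · intro X Y p
    rw [AInfData.insertSum_eq_ins, hm]
    exact c.ins_rootSum p
  · intro X Y f
    rw [hm]
    exact hc.rootSum_pair_unit f
  · intro X Y g
    rw [hm]
    exact hc.rootSum_unit_pair g
  · intro W X Y p q h
    rw [hm]
    exact hc.rootSum_unit p q h

end Contraction

/-! ### Full subcategories -/

namespace AInfData

open CSeq

variable {k : Type u} [CommRing k] {C : AInfData.{u, v, w} k} (s : Set C.Obj)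

variable (C) in
/-- A sequence in a full subcategory, as a sequence in the ambient category. -/
def fullMap {X Y : (C.full s).Obj} (p : CSeq (C.full s).Tot X Y) : CSeq C.Tot X.1 Y.1 :=
  p.map Subtype.val (fun f => f)

lemma fullMap_append {X Y Z : (C.full s).Obj} (p : CSeq (C.full s).Tot X Y)
    (q : CSeq (C.full s).Tot Y Z) :
    C.fullMap s (p.append q) = (C.fullMap s p).append (C.fullMap s q) :=
  CSeq.map_append _ _ p q

lemma length_fullMap {X Y : (C.full s).Obj} (p : CSeq (C.full s).Tot X Y) :
    (C.fullMap s p).length = p.length :=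
  CSeq.length_map _ _ p

lemma HomogSeq.fullMap {X Y : (C.full s).Obj} {p : CSeq (C.full s).Tot X Y} {n : ℤ}
    (h : (C.full s).HomogSeq p n) : C.HomogSeq (C.fullMap s p) n := by
  induction h with
  | nil X => exact .nil X.1
  | cons hf hp ih => exact .cons hf ih

lemma ins_full {A : Type*} [AddCommMonoid A] {X Y : (C.full s).Obj} (φ : CSeq C.Tot X.1 Y.1 → A)
    (p : CSeq (C.full s).Tot X Y) :
    ins (C.full s).m (fun {X Y} f => -signMap k ((C.full s).Hom X Y) f)
        (fun q => φ (C.fullMap s q)) p =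
      ins C.m (fun {X Y} f => -signMap k (C.Hom X Y) f) φ (C.fullMap s p) :=
  (ins_map (T := (C.full s).Tot) (T' := C.Tot) (C.full s).m _ Subtype.val (fun f => f) C.m
    (fun {X Y} f => -signMap k (C.Hom X Y) f) (fun _ => rfl) (fun _ => rfl) φ p).symm

/-- A full subcategory of a strictly unital `A_∞`-category is one. -/
theorem IsAInfCategory.full (h : C.IsAInfCategory) : (C.full s).IsAInfCategory := by
  have e : ∀ {W X Y Z : (C.full s).Obj} (p : CSeq (C.full s).Tot W X) (f : (C.full s).Tot X Y)
      (q : CSeq (C.full s).Tot Y Z), (C.full s).m (p.append (cons f q)) =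
        C.m ((C.fullMap s p).append (cons (Obj := C.Obj) (T := C.Tot) f (C.fullMap s q))) :=
    fun p f q => congrArg C.m (fullMap_append s p _)
  refine ⟨fun X => h.m_nil X.1, ⟨fun p f g q => ?_, fun p a f q => ?_⟩, fun p n hp => ?_,
    fun {X Y} p => ?_, fun f => h.m_two_unit f, fun g => h.unit_m_two g, fun p q hpq => ?_⟩
  · exact (e p (f + g) q).trans ((h.multilinear.map_add _ f g _).trans
      (congrArg₂ (· + ·) (e p f q) (e p g q)).symm)
  · exact (e p (a • f) q).trans ((h.multilinear.map_smul _ a f _).trans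
      (congrArg (a • ·) (e p f q)).symm)
  · have := h.degree _ n hp.fullMap
    rw [length_fullMap] at this
    exact this
  · exact (ins_full s (fun q => C.m q) p).trans (h.relation (C.fullMap s p))
  · refine (e p _ q).trans (h.m_unit _ _ ?_)
    rwa [length_fullMap, length_fullMap]

lemma fullIncl_of_two_le {X Y : (C.full s).Obj} (p : CSeq (C.full s).Tot X Y)
    (hp : 2 ≤ p.length) : C.fullIncl s p = 0 := by
  rcases p with _ | ⟨f, _ | ⟨g, p⟩⟩
  · rfl
  · simp [length] at hp
  · rfl

lemma sum_blocks_succ {C D : AInfData.{u, v, w} k} (F : C.Obj → D.Obj)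
    (G : ∀ {X Y : C.Obj}, CSeq C.Tot X Y → D.Tot (F X) (F Y)) {A : Type*} [AddCommMonoid A] (r : ℕ)
    {X Y Z : C.Obj} (f : C.Tot X Y) (p : CSeq C.Tot Y Z) (φ : CSeq D.Tot (F X) (F Z) → A) :
    ((blocks F G (r + 1) (cons f p)).map φ).sum = cutSum (fun _ a b =>
      ((blocks F G r b).map (fun q => φ (cons (G (cons f a)) q))).sum) p := by
  have key : ∀ {α : Type (max v w)} (l : List α) (F : α → List A),
      (l.flatMap F).sum = (l.map fun x => (F x).sum).sum := by
    intro α l F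
    induction l with
    | nil => simp
    | cons a l ih => simp [ih]
  rw [blocks, List.map_flatMap, key, properCuts, List.map_map]
  simp only [List.map_map]
  rfl

/-- The blocks of the inclusion with a nonzero contribution are the single morphisms. -/
lemma sum_blocks_fullIncl {A : Type*} [AddCommMonoid A] (r : ℕ) :
    ∀ {X Y : (C.full s).Obj} (p : CSeq (C.full s).Tot X Y) (φ : CSeq C.Tot X.1 Y.1 → A),
    (∀ {W Z : C.Obj} (a : CSeq C.Tot X.1 W) (b : CSeq C.Tot Z Y.1),
      φ (a.append (cons 0 b)) = 0) →
    ((blocks (C := C.full s) (D := C) Subtype.val (C.fullIncl s) r p).map φ).sum =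
      if r = p.length then φ (C.fullMap s p) else 0 := by
  induction r with
  | zero =>
    intro X Y p φ _
    cases p with
    | nil X => simp [blocks, length, fullMap, CSeq.map]
    | cons f p => simp [blocks, length]
  | succ r ih =>
    intro X Y p φ hφ
    cases p with
    | nil X => simp [blocks, properCuts, length]
    | cons f p =>
      refine (sum_blocks_succ _ _ r f p φ).trans ((cutSum_eq_nil_left _ p ?_).trans ?_)
      -- A first block with two or more entries puts the zero morphism into the sequence, where `φ`
      -- vanishes.
      · intro Z a b ha
        rw [fullIncl_of_two_le s (cons f a) (by simpa [length] using ha)]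
        refine List.sum_eq_zero fun x hx => ?_
        obtain ⟨y, -, rfl⟩ := List.mem_map.1 hx
        exact hφ (nil _) y
      · rw [ih p _ fun a b => hφ (cons (C.fullIncl s (cons f (nil _))) a) b]
        simp only [length, Nat.add_right_cancel_iff]
        rfl

lemma IsMultilinear.map_zero_entry {U : C.Obj → C.Obj → Type w'}
    [∀ X Y, AddCommGroup (U X Y)] [∀ X Y, Module k (U X Y)]
    {φ : ∀ {X Y : C.Obj}, CSeq C.Tot X Y → U X Y} (h : C.IsMultilinear (U := U) φ)
    {W X Y Z : C.Obj} (p : CSeq C.Tot W X) (q : CSeq C.Tot Y Z) :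
    φ (p.append (cons (0 : C.Tot X Y) q)) = 0 := by
  have := h.map_smul p (0 : k) (0 : C.Tot X Y) q
  rwa [zero_smul, zero_smul] at this

/-- The inclusion of a full subcategory is a strict functor. -/
theorem IsAInfCategory.isAInfFunctor_fullIncl (h : C.IsAInfCategory) :
    IsAInfFunctor (C.full s) C Subtype.val (C.fullIncl s) := by
  refine ⟨fun X => rfl, ⟨fun p f g q => ?_, fun p a f q => ?_⟩, fun {X Y} p n hp => ?_,
    fun {X Y} p => ?_, fun X => rfl, fun p q hpq => ?_⟩
  · rcases p with _ | ⟨f', _ | ⟨f'', p⟩⟩ <;> rcases q with _ | ⟨g', q⟩ <;>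
      first | exact (add_zero _).symm | rfl
  · rcases p with _ | ⟨f', _ | ⟨f'', p⟩⟩ <;> rcases q with _ | ⟨g', q⟩ <;>
      first | exact (smul_zero _).symm | rfl
  · cases hp with
    | nil X => exact zero_mem _
    | @cons _ Y _ f _ a _ hf hp =>
      cases hp with
      | nil X =>
        have : a + 0 + 1 - ((cons f (nil Y) : CSeq (C.full s).Tot _ _).length : ℤ) = a := by
          simp [length]
        rw [this]
        exact hf
      | cons hg hp => exact zero_mem _
  · rw [insertSum_eq_ins]
    simp only [sum_blocks_fullIncl s _ p (fun q => C.m q)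
      (fun a b => h.multilinear.map_zero_entry a b)]
    rw [Finset.sum_ite_eq']
    rcases Nat.eq_zero_or_pos p.length with hp | hp
    · cases p with
      | nil X => simp [length]
      | cons f p => simp [length] at hp
    · rw [if_pos (Finset.mem_Icc.2 ⟨hp, le_rfl⟩),
        ins_eq_single _ _ _ (fun q hq => fullIncl_of_two_le s q hq) p hp]
      rfl
  · exact fullIncl_of_two_le s _ (by rw [length_append]; simp only [length]; omega)

/-- A functor without higher components is multiplicative if the operations `m_1` vanish. -/
lemma IsAInfFunctor.map_m_pair {C D : AInfData.{u, v, w} k} {F : C.Obj → D.Obj}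
    {G : ∀ {X Y : C.Obj}, CSeq C.Tot X Y → D.Tot (F X) (F Y)} (h : IsAInfFunctor C D F G)
    (hG : ∀ {X Y : C.Obj} (p : CSeq C.Tot X Y), 2 ≤ p.length → G p = 0)
    (hD : ∀ {X Y : D.Obj} (f : D.Tot X Y), D.m (single f) = 0)
    {X Y Z : C.Obj} (g : C.Tot Y Z) (f : C.Tot X Y) :
    G (single (C.m (pair g f))) = D.m (pair (G (single g)) (G (single f))) := by
  have h2 := h.relation (pair g f)
  rw [insertSum_eq_ins, ins_eq_single _ _ _ (fun q hq => hG q hq) _ (by simp [pair, length])] at h2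
  rw [← h2]
  have e : (pair g f).length = 2 := rfl
  -- One block gives m_1 of the second component, which is zero; two blocks give the product of the
  -- images.
  rw [e, Finset.sum_Icc_succ_top (by norm_num), Finset.Icc_self, Finset.sum_singleton]
  have h1 : D.m (cons (G (cons f (cons g (CSeq.nil Z)))) (CSeq.nil (F Z))) = 0 := hD _
  simp [blocks, pair, single, properCuts, cuts, h1]

end AInfData

/-! ### Contractions over a field -/

section Existence

open CochainComplex.HomComplex

variable {k : Type u} [Field k] {𝒞 : Type v} [Category.{w} 𝒞] [Preadditive 𝒞] [Linear k 𝒞]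

/-- Split `f` onto its range and extend the section to all of `W`; both are possible over a field.
-/
lemma LinearMap.exists_generalizedInverse {V W : Type*} [AddCommGroup V] [Module k V]
    [AddCommGroup W] [Module k W] (f : V →ₗ[k] W) : ∃ g : W →ₗ[k] V, ∀ x, f (g (f x)) = f x := by
  obtain ⟨s, hs⟩ := f.rangeRestrict.exists_rightInverse_of_surjective f.range_rangeRestrict
  obtain ⟨g, hg⟩ := s.exists_extend
  refine ⟨g, fun x => ?_⟩
  have h1 : g (f x) = s (f.rangeRestrict x) := LinearMap.congr_fun hg (f.rangeRestrict x)
  have h2 := congrArg Subtype.val (LinearMap.congr_fun hs (f.rangeRestrict x))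
  rw [h1]
  exact h2

/-- Over a field each family of complexes has a contraction. -/
theorem Contraction.nonempty {ι : Type w'} (K : ι → CochainComplex 𝒞 ℤ) :
    Nonempty (Contraction k K) := by
  have hi : ∀ (X Y : ι) (n : ℤ), ∃ i : HomCohomology k (K X) (K Y) n →ₗ[k]
      cocycles k (K X) (K Y) n, ∀ x, Submodule.Quotient.mk (i x) = x := fun X Y n => by
    obtain ⟨i, hi⟩ := (Submodule.mkQ ((LinearMap.range (δ_hom k (K X) (K Y) (n - 1) n)).submoduleOf
      (cocycles k (K X) (K Y) n))).exists_rightInverse_of_surjective (Submodule.range_mkQ _)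
    exact ⟨i, fun x => LinearMap.congr_fun hi x⟩
  have hr : ∀ (X Y : ι) (n : ℤ), ∃ r : Cochain (K X) (K Y) n →ₗ[k] cocycles k (K X) (K Y) n,
      ∀ z : cocycles k (K X) (K Y) n, r z = z := fun X Y n => by
    obtain ⟨r, hr⟩ := (LinearMap.id : cocycles k (K X) (K Y) n →ₗ[k] _).exists_extend
    exact ⟨r, fun z => LinearMap.congr_fun hr z⟩
  have hg : ∀ (X Y : ι) (n m : ℤ), ∃ g : Cochain (K X) (K Y) n →ₗ[k] Cochain (K X) (K Y) m,
      ∀ x, δ m n (g (δ m n x)) = δ m n x := fun X Y n m =>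
    LinearMap.exists_generalizedInverse (δ_hom k (K X) (K Y) m n)
  choose i hi using hi
  choose r hr using hr
  choose g hg using hg
  have hδ : ∀ {X Y : ι} {n m : ℤ} (x : Cochain (K X) (K Y) n), n + 1 = m →
      ∃ z : cocycles k (K X) (K Y) m, z.1 = δ n m x := fun {X Y n m} x _ =>
    ⟨⟨δ n m x, δ_δ n m (m + 1) x⟩, rfl⟩
  have hz : ∀ {X Y : ι} {n : ℤ} (m : ℤ), n + 1 = m → ∀ z : cocycles k (K X) (K Y) n,
      δ n m z.1 = 0 := fun m h z => by subst h; exact z.2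
  let p : ∀ (X Y : ι) (n : ℤ), Cochain (K X) (K Y) n →ₗ[k] HomCohomology k (K X) (K Y) n :=
    fun X Y n => Submodule.mkQ _ ∘ₗ r X Y n
  have hp : ∀ (X Y : ι) (n : ℤ) (z : cocycles k (K X) (K Y) n),
      p X Y n z = Submodule.Quotient.mk z := fun X Y n z => by simp [p, hr]
  have hpδ : ∀ (X Y : ι) (n m : ℤ), n + 1 = m → ∀ f : Cochain (K X) (K Y) n,
      p X Y m (δ n m f) = 0 := fun X Y n m h f => by
    obtain ⟨z, hz⟩ := hδ f h
    obtain rfl : n = m - 1 := by omega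
    rw [← hz, hp, Submodule.Quotient.mk_eq_zero]
    exact ⟨f, hz.symm⟩
  -- Here `r` retracts cochains onto cocycles. The map r - ip takes values in coboundaries, `g`
  -- picks primitives, and 1 - r moves these into the chosen complement ker r of the cocycles. Thus
  -- rH = 0, and HH = 0 follows because H depends on its argument only through `r`.
  let H : ∀ (X Y : ι) (n m : ℤ), Cochain (K X) (K Y) n →ₗ[k] Cochain (K X) (K Y) m :=
    fun X Y n m => (LinearMap.id - (cocycles k (K X) (K Y) m).subtype ∘ₗ r X Y m) ∘ₗ g X Y n m ∘ₗ
      (cocycles k (K X) (K Y) n).subtype ∘ₗ (r X Y n - i X Y n ∘ₗ p X Y n)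
  have hH : ∀ (X Y : ι) (n m : ℤ) (f : Cochain (K X) (K Y) n), H X Y n m f =
      g X Y n m (r X Y n f - i X Y n (p X Y n f) : cocycles k (K X) (K Y) n) -
        r X Y m (g X Y n m (r X Y n f - i X Y n (p X Y n f) : cocycles k (K X) (K Y) n)) :=
    fun X Y n m f => rfl
  have hrH : ∀ (X Y : ι) (n m : ℤ) (f : Cochain (K X) (K Y) n), r X Y m (H X Y n m f) = 0 :=
    fun X Y n m f => by rw [hH, map_sub, hr, sub_self]
  refine ⟨⟨i, p, H, hi, hpδ, fun X Y n x => by rw [hp, hi], ?_, ?_, ?_⟩⟩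
  · intro X Y l n m hl hm f
    have h1 : δ l n (H X Y n l f) =
        (r X Y n f - i X Y n (p X Y n f) : cocycles k (K X) (K Y) n) := by
      have h2 : p X Y n (r X Y n f - i X Y n (p X Y n f) : cocycles k (K X) (K Y) n) = 0 := by
        rw [hp, Submodule.Quotient.mk_sub, hi]
        exact sub_self _
      rw [hp, Submodule.Quotient.mk_eq_zero] at h2
      obtain rfl : l = n - 1 := by omega
      obtain ⟨y, hy⟩ := h2
      have hy' : δ (n - 1) n y =
        (r X Y n f - i X Y n (p X Y n f) : cocycles k (K X) (K Y) n).1 := hy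
      rw [hH, δ_sub, hz n hl, sub_zero, ← hy', hg]
    have h2 : H X Y m n (δ n m f) = f - r X Y n f := by
      obtain ⟨z, hz'⟩ := hδ f hm
      rw [hH, hpδ X Y n m hm, map_zero, sub_zero, ← hz', hr, hz']
      -- The primitive chosen for the coboundary of `f` differs from `f` by a cocycle, and 1 - r
      -- removes that cocycle.
      have h3 : ∃ z : cocycles k (K X) (K Y) n, z.1 = g X Y m n (δ n m f) - f := by
        subst hm
        exact ⟨⟨_, by simp [cocycles, hg]⟩, rfl⟩
      obtain ⟨y, hy⟩ := h3
      have h4 : g X Y m n (δ n m f) = y.1 + f := by rw [hy, sub_add_cancel]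
      rw [h4, map_add, hr, Submodule.coe_add]
      abel
    rw [h1, h2, Submodule.coe_sub]
    abel
  · intro X Y l n m _ _ f
    rw [hH, show p X Y n (H X Y m n f) = 0 from congrArg Submodule.Quotient.mk (hrH X Y m n f),
      hrH]
    simp
  · intro X Y l n _ x
    rw [hH, hr, hp, hi]
    simp

end Existence

/-! ### Cochains between the resolutions of the simple modules -/

namespace PiA2

variable {k : Type u} [Field k]

lemma mul_eq_zero_of_e_eq_zero {x y : PiA2 k} (hx : x.e = 0) (hy : y.e = 0) : x * y = 0 := by
  ext l <;> simp [hx, hy]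

lemma zmod_two_add_one (l : ZMod 2) : l + 1 + 1 = l := by revert l; decide

lemma zmod_two_ne (l : ZMod 2) : l + 1 ≠ l := by revert l; decide

lemma zmod_two_eq_add_one {l m : ZMod 2} (h : l ≠ m) : l = m + 1 := by revert l m; decide

lemma idem_mul_arr (i : ZMod 2) : (idem (i + 1) * arr i : PiA2 k) = arr i := by
  ext l
  · simp [arr]
  · by_cases hl : l = i <;> simp [idem, arr, hl]

/-- An element of `(a) Π (b)` with `a ≠ b` is a multiple of an arrow. -/
lemma eq_smul_arr {x : PiA2 k} {a b : ZMod 2} (hab : a ≠ b) (ha : idem a * x = x)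
    (hb : x * idem b = x) : x = x.a b • arr b := by
  have he : ∀ l, x.e l = 0 := fun l => by
    have h1 := congrArg (fun y => e y l) ha
    have h2 := congrArg (fun y => e y l) hb
    simp only [mul_e, idem, Pi.single_apply] at h1 h2
    split_ifs at h1 h2 with h3 h4
    · exact absurd (h3.symm.trans h4) hab
    all_goals simp_all
  ext l
  · simp [he, arr]
  · have h2 := congrArg (fun y => PiA2.a y l) hb
    by_cases hl : l = b
    · simp [hl, arr]
    · simpa [idem, arr, Pi.single_apply, hl, eq_comm] using h2

/-- An element of `(a) Π (a)` is a multiple of an idempotent. -/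
lemma eq_smul_idem {x : PiA2 k} {a : ZMod 2} (ha : idem a * x = x) (hb : x * idem a = x) :
    x = x.e a • idem a := by
  ext l
  · have h2 := congrArg (fun y => e y l) hb
    by_cases hl : l = a
    · simp [hl, idem]
    · simpa [idem, Pi.single_apply, hl, eq_comm] using h2
  · have h1 := congrArg (fun y => PiA2.a y l) ha
    have h2 := congrArg (fun y => PiA2.a y l) hb
    by_cases hl : l = a
    · subst hl
      have := zmod_two_ne l
      simpa [idem, Pi.single_apply, this, eq_comm] using h1
    · simpa [idem, Pi.single_apply, hl, eq_comm] using h2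

end PiA2

/-! ### Cochains as families of algebra elements -/

namespace PObj

open PiA2 CochainComplex.HomComplex

variable {k : Type u} [Field k]

/-- The generator of the term in degree `p` of the resolution of `S_j`, or zero for `p > 0`. -/
def genElt (k : Type u) [Field k] (j : ZMod 2) (p : ℤ) : PiA2 k :=
  if p ≤ 0 then idem (j + p) else 0

lemma genElt_mem (j : ZMod 2) (p : ℤ) : genElt k j p ∈ term k (S j) p := by
  simp only [genElt, term]
  split_ifs with h
  · rw [mem_proj, idem_mul_idem]
  · exact zero_mem _

lemma mul_genElt {j : ZMod 2} {p : ℤ} {x : PiA2 k} (hx : x ∈ term k (S j) p) :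
    x * genElt k j p = x := by
  simp only [genElt]
  simp only [term] at hx
  split_ifs at hx ⊢ with h
  · exact (mem_proj _ _).1 hx
  · rw [(Submodule.mem_bot _).1 hx, zero_mul]

lemma genElt_mul_dElt (j : ZMod 2) {p q : ℤ} (h : p + 1 = q) :
    genElt k j p * dElt k (S j) p q = dElt k (S j) p q := by
  simp only [genElt, dElt]
  split_ifs with h1 h2 h2
  · rw [← idem_mul_arr, ← mul_assoc, ← h]
    have : j + (p : ZMod 2) = j + ((p + 1 : ℤ) : ZMod 2) + 1 := by
      push_cast
      rw [← add_assoc, zmod_two_add_one]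
    rw [← this, idem_mul_idem]
  · rw [mul_zero]
  · omega
  · rw [mul_zero]

/-- A module map between terms of the resolutions, as a component of a cochain. -/
def app {j i : ZMod 2} {n : ℤ} (f : Cochain (cpx k (S j)) (cpx k (S i)) n) (p q : ℤ)
    (h : p + n = q) : term k (S j) p →ₗ[PiA2 k] term k (S i) q := (f.v p q h).hom

/-- The element by which a component of a cochain multiplies. -/
def elt {j i : ZMod 2} {n : ℤ} (f : Cochain (cpx k (S j)) (cpx k (S i)) n) (p q : ℤ)
    (h : p + n = q) : PiA2 k := app f p q h ⟨genElt k j p, genElt_mem j p⟩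

variable {j i : ZMod 2} {n : ℤ}

/-- A linear map out of a left ideal generated by an idempotent is right multiplication by the image
of that idempotent. -/
lemma app_apply (f : Cochain (cpx k (S j)) (cpx k (S i)) n) (p q : ℤ) (h : p + n = q)
    (x : term k (S j) p) : (app f p q h x : PiA2 k) = x * elt f p q h := by
  have : x = (x : PiA2 k) • (⟨genElt k j p, genElt_mem j p⟩ : term k (S j) p) :=
    Subtype.ext (mul_genElt x.2).symm
  conv_lhs => rw [this, map_smul]
  rfl

lemma cochain_ext {f g : Cochain (cpx k (S j)) (cpx k (S i)) n}
    (h : ∀ p q hpq, elt f p q hpq = elt g p q hpq) : f = g := by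
  ext p q hpq : 1
  refine ModuleCat.hom_ext (LinearMap.ext fun x => Subtype.ext ?_)
  exact (app_apply f p q hpq x).trans ((congrArg _ (h p q hpq)).trans (app_apply g p q hpq x).symm)

lemma elt_mem (f : Cochain (cpx k (S j)) (cpx k (S i)) n) (p q : ℤ) (h : p + n = q) :
    elt f p q h ∈ term k (S i) q := (app f p q h _).2

lemma elt_mul_genElt (f : Cochain (cpx k (S j)) (cpx k (S i)) n) (p q : ℤ) (h : p + n = q) :
    elt f p q h * genElt k i q = elt f p q h := mul_genElt (elt_mem f p q h)

lemma genElt_mul_elt (f : Cochain (cpx k (S j)) (cpx k (S i)) n) (p q : ℤ) (h : p + n = q) :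
    genElt k j p * elt f p q h = elt f p q h := 
  (app_apply f p q h ⟨genElt k j p, genElt_mem j p⟩).symm

lemma elt_eq_zero_of_pos_left (f : Cochain (cpx k (S j)) (cpx k (S i)) n) {p q : ℤ} (h : p + n = q)
    (hp : 0 < p) : elt f p q h = 0 := by
  rw [← genElt_mul_elt, genElt, if_neg (by omega), zero_mul]

lemma elt_eq_zero_of_pos_right (f : Cochain (cpx k (S j)) (cpx k (S i)) n) {p q : ℤ}
    (h : p + n = q) (hq : 0 < q) : elt f p q h = 0 := by
  rw [← elt_mul_genElt, genElt, if_neg (by omega), mul_zero]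

lemma elt_add (f g : Cochain (cpx k (S j)) (cpx k (S i)) n) (p q : ℤ) (h : p + n = q) :
    elt (f + g) p q h = elt f p q h + elt g p q h := rfl

lemma elt_zero (p q : ℤ) (h : p + n = q) :
    elt (0 : Cochain (cpx k (S j)) (cpx k (S i)) n) p q h = 0 := rfl

lemma elt_smul (a : k) (f : Cochain (cpx k (S j)) (cpx k (S i)) n) (p q : ℤ) (h : p + n = q) :
    elt (a • f) p q h = a • elt f p q h := by
  rw [Algebra.smul_def]
  rfl

lemma elt_mk (y : ℤ → ℤ → PiA2 k) 
    (hy : ∀ p q : ℤ, ∀ x ∈ term k (S j) p, x * y p q ∈ term k (S i) q)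
    (p q : ℤ) (h : p + n = q) :
    elt (Cochain.mk (fun p q (_ : p + n = q) => rightMul _ _ (y p q) (hy p q)) :
      Cochain (cpx k (S j)) (cpx k (S i)) n) p q h = genElt k j p * y p q := rfl

lemma elt_comp {l : ZMod 2} {m s : ℤ} (f : Cochain (cpx k (S j)) (cpx k (S i)) n)
    (g : Cochain (cpx k (S i)) (cpx k (S l)) m) (h : n + m = s) {p q r : ℤ} (hpq : p + n = q)
    (hqr : q + m = r) (hpr : p + s = r) :
    elt (f.comp g h) p r hpr = elt f p q hpq * elt g q r hqr := by
  refine Eq.trans ?_ (app_apply g q r hqr (app f p q hpq ⟨genElt k j p, genElt_mem j p⟩))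
  unfold elt app
  rw [Cochain.comp_v f g h p q r hpq hqr]
  rfl

/-- Composites of right multiplications are products in the order of application, so the
differential of a cochain becomes a computation in the algebra. -/
lemma elt_δ {m : ℤ} (hnm : n + 1 = m) (f : Cochain (cpx k (S j)) (cpx k (S i)) n) {p q q₁ q₂ : ℤ}
    (hpq : p + m = q) (h1 : p + n = q₁) (h2 : p + 1 = q₂) :
    elt (δ n m f) p q hpq = elt f p q₁ h1 * dElt k (S i) q₁ q +
      (m.negOnePow : ℤ) • (dElt k (S j) p q₂ * elt f q₂ q (by omega)) := by
  have h3 := app_apply f q₂ q (by omega)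
    ⟨genElt k j p * dElt k (S j) p q₂, mul_dElt_mem (S j) p q₂ (genElt k j p)⟩
  change _ = genElt k j p * dElt k (S j) p q₂ * _ at h3
  rw [← genElt_mul_dElt j h2, ← h3]
  unfold elt app
  rw [δ_v n m hnm f p q hpq q₁ q₂ (by omega) h2]
  rcases Int.units_eq_one_or m.negOnePow with h | h <;> rw [h]
  · rw [one_smul, Units.val_one, one_smul]
    rfl
  · rw [Units.neg_smul, one_smul, Units.val_neg, Units.val_one, neg_smul, one_smul]
    rfl

end PObj

/-! ### Cohomology of the complexes between simple modules -/

namespace PObj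

open PiA2 CochainComplex.HomComplex

variable {k : Type u} [Field k] {j i : ZMod 2} {n : ℤ}

/-- The components of a cochain of degree `n ≢ j - i` are multiples of arrows. -/
lemma elt_eq_smul_arr (hn : j ≠ i + n) (f : Cochain (cpx k (S j)) (cpx k (S i)) n) (p q : ℤ)
    (h : p + n = q) : elt f p q h = (elt f p q h).a (i + q) • arr (i + q) := by
  by_cases hp : p ≤ 0
  · by_cases hq : q ≤ 0
    · have h1 := genElt_mul_elt f p q h
      have h2 := elt_mul_genElt f p q h
      rw [genElt, if_pos hp] at h1
      rw [genElt, if_pos hq] at h2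
      refine eq_smul_arr (fun h3 => hn ?_) h1 h2
      rw [← h] at h3
      push_cast at h3
      linear_combination h3
    · rw [elt_eq_zero_of_pos_right f h (by omega)]
      simp
  · rw [elt_eq_zero_of_pos_left f h (by omega)]
    simp

/-- The components of a cochain of degree `n ≡ j - i` are multiples of idempotents. -/
lemma elt_eq_smul_idem (hn : j = i + n) (f : Cochain (cpx k (S j)) (cpx k (S i)) n) (p q : ℤ)
    (h : p + n = q) : elt f p q h = (elt f p q h).e (i + q) • idem (i + q) := by
  by_cases hp : p ≤ 0
  · by_cases hq : q ≤ 0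
    · have h1 := genElt_mul_elt f p q h
      have h2 := elt_mul_genElt f p q h
      rw [genElt, if_pos hp] at h1
      rw [genElt, if_pos hq] at h2
      refine eq_smul_idem ?_ h2
      convert h1 using 3
      rw [hn, ← h]
      push_cast
      ring
    · rw [elt_eq_zero_of_pos_right f h (by omega)]
      simp
  · rw [elt_eq_zero_of_pos_left f h (by omega)]
    simp

lemma dElt_e (p q : ℤ) : (dElt k (S j) p q).e = 0 := by
  simp only [dElt]
  split_ifs <;> rfl

/-- There are no coboundaries in the degrees `n ≡ j - i`. -/
lemma δ_eq_zero (hn : j = i + n) {l : ℤ} (hl : l + 1 = n)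
    (y : Cochain (cpx k (S j)) (cpx k (S i)) l) : δ l n y = 0 := by
  have hl' : j ≠ i + l := by
    rw [hn, ← hl]
    push_cast
    rw [← add_assoc]
    exact zmod_two_ne _
  -- Degree `l` has the other parity, so the components of `y` are multiples of arrows, and their
  -- products with the arrows of the differentials vanish.
  have he : ∀ p q h, (elt y p q h).e = 0 := fun p q h => by
    rw [elt_eq_smul_arr hl' y p q h]
    ext t
    simp [arr]
  refine cochain_ext fun p q h => ?_
  rw [elt_δ hl y h rfl rfl, mul_eq_zero_of_e_eq_zero (he _ _ _) (dElt_e _ _),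
    mul_eq_zero_of_e_eq_zero (dElt_e _ _) (he _ _ _), smul_zero, add_zero, elt_zero]

/-- A sequence indexed by the nonpositive integers and given by a descending recursion. -/
lemma exists_descending_rec (a : ℤ → k) (s : k) :
    ∃ c : ℤ → k, (∀ p ≤ 0, c p = a p - s * c (p + 1)) ∧ ∀ p, 0 < p → c p = 0 := by
  -- The entry `b t` is the value at 1 - t; the recursion starts from zero in degree 1.
  let b : ℕ → k := fun t => Nat.rec 0 (fun t x => a (-t) - s * x) t
  refine ⟨fun p => b (1 - p).toNat, fun p hp => ?_, fun p hp => ?_⟩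
  · obtain ⟨t, rfl⟩ : ∃ t : ℕ, p = -t := ⟨(-p).toNat, by omega⟩
    have h1 : (1 - -(t : ℤ)).toNat = t + 1 := by omega
    have h2 : (1 - (-(t : ℤ) + 1)).toNat = t := by omega
    simp only [h1, h2, b]
  · have h1 : (1 - p).toNat = 0 := by omega
    simp only [h1]
    rfl

/-- All cochains are coboundaries in the degrees `n ≢ j - i`. -/
lemma exists_δ_eq (hn : j ≠ i + n) {l : ℤ} (hl : l + 1 = n)
    (z : Cochain (cpx k (S j)) (cpx k (S i)) n) :
    ∃ y : Cochain (cpx k (S j)) (cpx k (S i)) l, δ l n y = z := by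
  -- If y has idempotent coefficients c_p, its coboundary has arrow coefficients c_p + (-1)^n
  -- c_{p+1}. Given the coefficients of `z`, this is solved downwards from c_1 = 0.
  obtain ⟨c, hc, hc0⟩ := exists_descending_rec
    (fun p => (elt z p (p + n) rfl).a (i + (p + n : ℤ))) (((n.negOnePow : ℤ) : k))
  let y : ℤ → ℤ → PiA2 k := fun p q => if q ≤ 0 then c p • idem (i + q) else 0
  have hy : ∀ p q : ℤ, ∀ x ∈ term k (S j) p, x * y p q ∈ term k (S i) q := by
    intro p q x _
    simp only [y, term]
    split_ifs
    · rw [mem_proj, mul_assoc, smul_mul_assoc, idem_mul_idem]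
    · simp
  refine ⟨Cochain.mk (fun p q _ => rightMul _ _ (y p q) (hy p q)), cochain_ext fun p q h => ?_⟩
  by_cases hp : p ≤ 0
  swap
  · rw [elt_eq_zero_of_pos_left _ h (by omega), elt_eq_zero_of_pos_left _ h (by omega)]
  by_cases hq : q ≤ 0
  swap
  · rw [elt_eq_zero_of_pos_right _ h (by omega), elt_eq_zero_of_pos_right _ h (by omega)]
  have hjn : j = i + n + 1 := zmod_two_eq_add_one hn
  have e1 : j + (p : ZMod 2) = i + ((p + l : ℤ) : ZMod 2) := by
    rw [hjn, ← hl]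
    push_cast
    linear_combination (zmod_two_add_one i)
  have e2 : j + ((p + 1 : ℤ) : ZMod 2) = i + (q : ZMod 2) := by
    rw [hjn, ← h]
    push_cast
    linear_combination (zmod_two_add_one i)
  rw [elt_δ hl _ h rfl rfl, elt_mk, elt_mk, elt_eq_smul_arr hn z p q h]
  have d1 : dElt k (S i) (p + l) q = arr (i + q) := if_pos ⟨by omega, hq⟩
  have g1 : genElt k j p * y p (p + l) = c p • idem (i + ((p + l : ℤ) : ZMod 2)) := by
    simp only [genElt, y, if_pos hp, if_pos (show p + l ≤ 0 by omega)]
    rw [e1, mul_smul_comm, idem_mul_idem]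
  have g2 : dElt k (S j) p (p + 1) * (genElt k j (p + 1) * y (p + 1) q) =
      c (p + 1) • arr (i + q) := by
    by_cases hp1 : p + 1 ≤ 0
    · have d2 : dElt k (S j) p (p + 1) = arr (j + ((p + 1 : ℤ) : ZMod 2)) := if_pos ⟨rfl, hp1⟩
      rw [d2]
      simp only [genElt, y, if_pos hp1, if_pos hq]
      rw [e2, mul_smul_comm, idem_mul_idem, mul_smul_comm, arr_mul_idem]
    · have d2 : dElt k (S j) p (p + 1) = 0 := if_neg (fun h => hp1 h.2)
      rw [d2, hc0 _ (by omega), zero_smul, zero_mul]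
  rw [g2, d1, g1, hc p hp, smul_mul_assoc]
  have e3 : idem (i + ((p + l : ℤ) : ZMod 2)) * arr (i + (q : ZMod 2)) =
      (arr (i + (q : ZMod 2)) : PiA2 k) := by
    have : i + ((p + l : ℤ) : ZMod 2) = i + (q : ZMod 2) + 1 := by
      rw [← h, ← hl]
      push_cast
      linear_combination -(zmod_two_add_one i)
    rw [this, idem_mul_arr]
  subst h
  rw [e3, ← Int.cast_smul_eq_zsmul k, smul_smul, ← add_smul]
  congr 1
  ring

/-- A cocycle of degree `n ≡ j - i`, `n ≤ 0`, vanishes if `n < 0` or its component in degree zero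
vanishes. -/
lemma eq_zero_of_cocycle (hn : j = i + n) (hn0 : n ≤ 0) (z : Cochain (cpx k (S j)) (cpx k (S i)) n)
    (hz : δ n (n + 1) z = 0) (h0 : n = 0 → ∀ q h, elt z 0 q h = 0) : z = 0 := by
  -- Descending induction from p = 1: while q + 1 ≤ 0, the cocycle equation determines the
  -- coefficient at p by the one at p + 1.
  have key : ∀ t : ℕ, ∀ p : ℤ, p = 1 - t → ∀ q h, elt z p q h = 0 := by
    intro t
    induction t with
    | zero => exact fun p hp q h => elt_eq_zero_of_pos_left _ h (by omega)
    | succ t ih =>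
      intro p hp q h
      by_cases hq : q + 1 ≤ 0
      · have h1 := elt_δ rfl z (show p + (n + 1) = q + 1 by omega) h rfl
        rw [hz, elt_zero, ih (p + 1) (by omega), mul_zero, smul_zero, add_zero,
          show dElt k (S i) q (q + 1) = arr (i + (q + 1 : ℤ)) from if_pos ⟨rfl, hq⟩,
          elt_eq_smul_idem hn z p q h, smul_mul_assoc] at h1
        have e3 : i + (q : ZMod 2) = i + ((q + 1 : ℤ) : ZMod 2) + 1 := by
          push_cast
          rw [← add_assoc, zmod_two_add_one]
        rw [elt_eq_smul_idem hn z p q h]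
        have h2 := congrArg (fun x => a x (i + ((q + 1 : ℤ) : ZMod 2))) h1
        rw [e3] at h2
        rw [idem_mul_arr] at h2
        have h3 : (elt z p q h).e (i + ((q + 1 : ℤ) : ZMod 2) + 1) = 0 := by
          simpa [arr] using h2.symm
        rw [e3, h3, zero_smul]
      -- Now q ≥ 0, while p and n are nonpositive. Only p = n = 0 is possible, which `h0` covers.
      · by_cases hp0 : p = 0 ∧ n = 0
        · obtain ⟨rfl, h3⟩ := hp0
          exact h0 h3 q h
        · exact elt_eq_zero_of_pos_right _ h (by omega)
  refine cochain_ext fun p q h => ?_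
  rw [elt_zero]
  by_cases hp : p ≤ 0
  · exact key (1 - p).toNat p (by omega) q h
  · exact elt_eq_zero_of_pos_left _ h (by omega)

lemma elt_id (p q : ℤ) (h : p + 0 = q) :
    elt (Cochain.ofHom (𝟙 (cpx k (S i)))) p q h = genElt k i p := by
  obtain rfl : p = q := by omega
  unfold elt app
  rw [Cochain.ofHom_v]
  rfl

/-- A cocycle of degree zero is a multiple of the identity. -/
lemma eq_smul_id_of_cocycle (z : Cochain (cpx k (S i)) (cpx k (S i)) 0) (hz : δ 0 1 z = 0) :
    ∃ a : k, z = a • Cochain.ofHom (𝟙 (cpx k (S i))) := by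
  refine ⟨(elt z 0 0 rfl).e i, ?_⟩
  rw [← sub_eq_zero]
  have hi : i = i + ((0 : ℤ) : ZMod 2) := by simp
  refine eq_zero_of_cocycle hi le_rfl _ ?_ fun _ q h => ?_
  · rw [zero_add, δ_sub, hz, δ_smul, δ_ofHom, smul_zero, sub_zero]
  · obtain rfl : q = 0 := by omega
    rw [sub_eq_add_neg, ← neg_one_smul k, elt_add, elt_smul, elt_smul, elt_id,
      elt_eq_smul_idem hi z 0 0 h]
    simp only [genElt, if_pos le_rfl, ← hi, neg_smul, one_smul]
    simp [idem]

/-- The identity component of `extCochain`. -/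
lemma elt_extCochain {p q : ℤ} (h : p + 1 = q) :
    elt (extCochain k j (j + 1)) p q h =
      if q ≤ 0 then (q.negOnePow : ℤ) • idem (j + p) else 0 := by
  have e : j + 1 + (q : ZMod 2) = j + (p : ZMod 2) := by
    rw [← h]
    push_cast
    linear_combination zmod_two_add_one j
  change genElt k j p * extElt k (j + 1) q = _
  simp only [genElt, extElt]
  by_cases hq : q ≤ 0
  · rw [if_pos hq, if_pos (by omega), if_pos hq, e, mul_smul_comm, idem_mul_idem]
  · rw [if_neg hq, if_neg hq, mul_zero]

/-- A cocycle of positive degree factors through the degree one class that starts at the same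
simple module. -/
lemma exists_comp_extCochain (hn0 : 0 ≤ n) (z : Cochain (cpx k (S j)) (cpx k (S i)) (1 + n))
    (hz : δ (1 + n) (1 + n + 1) z = 0) :
    ∃ w : Cochain (cpx k (S (j + 1))) (cpx k (S i)) n, δ n (n + 1) w = 0 ∧
      (extCochain k j (j + 1)).comp w rfl = z := by
  -- The degree one map is (-1)^p times the identity into degree p, so the factor is `z` shifted by
  -- one with this sign undone.
  let y : ℤ → ℤ → PiA2 k := fun p q =>
    if h : p - 1 + (1 + n) = q then (p.negOnePow : ℤ) • elt z (p - 1) q h else 0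
  have hy : ∀ p q : ℤ, ∀ x ∈ term k (S (j + 1)) p, x * y p q ∈ term k (S i) q := by
    intro p q x _
    simp only [y]
    split_ifs with h
    · rw [mul_smul_comm]
      exact zsmul_mem (Submodule.smul_mem _ x (elt_mem z _ _ _)) _
    · simp
  let w : Cochain (cpx k (S (j + 1))) (cpx k (S i)) n :=
    Cochain.mk (fun p q _ => rightMul _ _ (y p q) (hy p q))
  have hw : (extCochain k j (j + 1)).comp w rfl = z := by
    refine cochain_ext fun p q h => ?_
    rw [elt_comp _ w rfl rfl (show p + 1 + n = q by omega) h, elt_extCochain]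
    by_cases hp : p + 1 ≤ 0
    · rw [if_pos hp, elt_mk]
      have e : j + 1 + ((p + 1 : ℤ) : ZMod 2) = j + (p : ZMod 2) := by
        push_cast
        linear_combination zmod_two_add_one j
      have hy' : y (p + 1) q = ((p + 1).negOnePow : ℤ) • elt z p q h := by
        have : p + 1 - 1 = p := by ring
        simp only [y, this]
        exact dif_pos h
      have hg := genElt_mul_elt z p q h
      simp only [genElt, if_pos (show p ≤ 0 by omega)] at hg
      rw [hy', genElt, if_pos hp, e, mul_smul_comm, mul_smul_comm, smul_mul_assoc, ← mul_assoc,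
        idem_mul_idem, hg, smul_smul, Int.units_coe_mul_self, one_smul]
    -- The degree one map has no component here, so `z` must have none either. Indeed q = p + 1 + n
    -- is positive, because 0 ≤ n.
    · rw [if_neg hp, zero_mul, elt_eq_zero_of_pos_right z h (by omega)]
  refine ⟨w, ?_, hw⟩
  -- As both `z` and the degree one map are cocycles, the Leibniz rule leaves only this term. The
  -- degree one map can then be cancelled, being invertible into each degree p ≤ 0.
  have h1 : (extCochain k j (j + 1)).comp (δ n (n + 1) w) rfl = 0 := by
    have h2 := δ_comp (extCochain k j (j + 1)) w rfl (1 + 1) (n + 1) (1 + n + 1) rfl rfl rfl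
    rw [hw, hz, δ_extCochain, Cochain.zero_comp, smul_zero, add_zero] at h2
    have h3 : ∀ (s : ℤ) (hs : 1 + (n + 1) = s), s = 1 + n + 1 →
        (extCochain k j (j + 1)).comp (δ n (n + 1) w) hs = 0 := by
      rintro s hs rfl
      exact h2.symm
    exact h3 _ rfl (by ring)
  refine cochain_ext fun p q h => ?_
  rw [elt_zero]
  by_cases hp : p ≤ 0
  · have h2 := elt_comp (extCochain k j (j + 1)) (δ n (n + 1) w) rfl (sub_add_cancel p 1) h
      (show p - 1 + (1 + (n + 1)) = q by omega)
    rw [h1, elt_zero, elt_extCochain, if_pos hp, ← genElt_mul_elt _ p q h, genElt, if_pos hp] at h2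
    have e : j + ((p - 1 : ℤ) : ZMod 2) = j + 1 + (p : ZMod 2) := by
      push_cast
      linear_combination -zmod_two_add_one j
    rw [e, smul_mul_assoc, ← mul_assoc, idem_mul_idem] at h2
    have hg := genElt_mul_elt (δ n (n + 1) w) p q h
    simp only [genElt, if_pos hp] at hg
    rw [hg] at h2
    have h3 := congrArg ((p.negOnePow : ℤ) • ·) h2
    simp only [smul_zero, smul_smul, Int.units_coe_mul_self, one_smul] at h3
    exact h3.symm
  · exact elt_eq_zero_of_pos_left _ h (by omega)

end PObj

/-! ### Values of a contraction on cocycles -/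

namespace Contraction

open CochainComplex.HomComplex

variable {k : Type u} [CommRing k] {𝒞 : Type v} [Category.{w} 𝒞] [Preadditive 𝒞] [Linear k 𝒞]
  {ι : Type w'} {K : ι → CochainComplex 𝒞 ℤ} (c : Contraction k K) {X Y : ι} {n : ℤ}

lemma cocycle_sub_i_p (z : Cochain (K X) (K Y) n) (hz : δ n (n + 1) z = 0) :
    z - c.i X Y n (c.p X Y n z) = δ (n - 1) n (c.H X Y n (n - 1) z) := by
  rw [c.homotopy X Y (n - 1) n (n + 1) (sub_add_cancel n 1) rfl, hz, map_zero, add_zero]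

/-- The projection of a contraction maps a cocycle to its class. -/
lemma p_cocycle (z : Cochain (K X) (K Y) n) (hz : δ n (n + 1) z = 0) :
    c.p X Y n z = cohClass k z hz := by
  rw [← c.class_i X Y n (c.p X Y n z), eq_comm, cohClass, Submodule.Quotient.eq]
  exact ⟨c.H X Y n (n - 1) z, (c.cocycle_sub_i_p z hz).symm⟩

/-- In a degree without coboundaries each cocycle represents its own class. -/
lemma i_cohClass (h : ∀ y : Cochain (K X) (K Y) (n - 1), δ (n - 1) n y = 0)
    (z : Cochain (K X) (K Y) n) (hz : δ n (n + 1) z = 0) :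
    (c.i X Y n (cohClass k z hz) : Cochain (K X) (K Y) n) = z := by
  have h1 := c.cocycle_sub_i_p z hz
  rw [h, c.p_cocycle z hz, sub_eq_zero] at h1
  exact h1.symm

lemma cohClass_i (x : HomCohomology k (K X) (K Y) n) :
    cohClass k (c.i X Y n x : Cochain (K X) (K Y) n) (c.i X Y n x).2 = x :=
  c.class_i X Y n x

end Contraction

/-! ### Formality and generation of the category of simples -/

section Simples

open CochainComplex.HomComplex PObj CSeq

variable {k : Type u} [Field k] (c : Contraction k (cpx k)) {j i l : ZMod 2} {n : ℤ}

/-- Degree 0 has no coboundaries: by parity for the simple modules, and because the complex of a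
projective has zero differential. -/
lemma isUnital_cpx : c.IsUnital := by
  intro X
  refine c.i_cohClass (fun y => ?_) _ _
  cases X with
  | S i => exact δ_eq_zero (by simp) (by omega) y
  | P i =>
    refine Cochain.ext _ _ fun p q h => ?_
    rw [δ_v (0 - 1) 0 (by omega) y p q h (q - 1) (p + 1) rfl rfl]
    have hd : ∀ a b, (cpx k (P i)).d a b = 0 := fun a b =>
      ModuleCat.hom_ext (LinearMap.ext fun x => Subtype.ext (mul_zero x.1))
    rw [hd, hd, Limits.comp_zero, Limits.zero_comp, smul_zero, add_zero]
    rfl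

/-- `Ext^n(S_j, S_i)` vanishes unless `n ≡ j - i`. -/
lemma homCohomology_eq_zero (hn : j ≠ i + n) (x : HomCohomology k (cpx k (S j)) (cpx k (S i)) n) :
    x = 0 := by
  obtain ⟨z, rfl⟩ := Submodule.Quotient.mk_surjective _ x
  obtain ⟨y, hy⟩ := exists_δ_eq hn (sub_add_cancel n 1) z.1
  exact (Submodule.Quotient.mk_eq_zero _).2 ⟨y, hy⟩

/-- The representatives of the classes between simple modules are closed under composition. -/
lemma signedComp_mem_range_iTot (y : ⨁ n, HomCohomology k (cpx k (S i)) (cpx k (S l)) n)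
    (x : ⨁ n, HomCohomology k (cpx k (S j)) (cpx k (S i)) n) :
    signedComp k (cpx k (S j)) (cpx k (S i)) (cpx k (S l)) (c.iTot _ _ y) (c.iTot _ _ x) ∈
      LinearMap.range (c.iTot (S j) (S l)) := by
  induction y using DirectSum.induction_on with
  | zero => simp
  | add y y' h h' => simp only [map_add, LinearMap.add_apply]; exact add_mem h h'
  | of b y =>
  induction x using DirectSum.induction_on with
  | zero => simp
  | add x x' h h' => simp only [map_add]; exact add_mem h h'
  | of a x =>
  change signedComp k _ _ _ (c.iTot _ _ (lof k ℤ _ b y)) (c.iTot _ _ (lof k ℤ _ a x)) ∈ _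
  by_cases hx : j = i + a
  swap
  · rw [homCohomology_eq_zero hx x, map_zero, map_zero, map_zero]
    exact zero_mem _
  by_cases hy : i = l + b
  swap
  · rw [homCohomology_eq_zero hy y, map_zero, map_zero, map_zero, LinearMap.zero_apply]
    exact zero_mem _
  rw [Contraction.iTot_lof, Contraction.iTot_lof, signedComp_lof rfl]
  have hz : δ (a + b) (a + b + 1)
      ((c.i (S j) (S i) a x).1.comp (c.i (S i) (S l) b y).1 rfl) = 0 := by
    rw [δ_comp _ _ rfl (a + 1) (b + 1) (a + b + 1) rfl rfl rfl,
      show δ a (a + 1) (c.i (S j) (S i) a x).1 = 0 from (c.i (S j) (S i) a x).2,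
      show δ b (b + 1) (c.i (S i) (S l) b y).1 = 0 from (c.i (S i) (S l) b y).2,
      Cochain.comp_zero, Cochain.zero_comp, smul_zero, add_zero]
  have hjl : j = l + ((a + b : ℤ) : ZMod 2) := by
    rw [hx, hy]
    push_cast
    ring
  -- The composite is a cocycle in a degree without coboundaries, so i returns it unchanged from its
  -- class.
  rw [← c.i_cohClass (fun y => δ_eq_zero hjl (sub_add_cancel _ 1) y) _ hz, ← Contraction.iTot_lof]
  exact zsmul_mem (LinearMap.mem_range_self _ _) _

lemma branchSum_mem_range_iTot (n : ℕ)
    (hn : ∀ {X Y : {X : PObj | ∃ i, X = S i}} (p : CSeq (fun X Y : {X : PObj | ∃ i, X = S i} =>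
      ⨁ n, HomCohomology k (cpx k X.1) (cpx k Y.1) n) X Y),
      c.edgeSum n (p.map Subtype.val (fun f => f)) ∈ LinearMap.range (c.iTot X.1 Y.1))
    {X Y : {X : PObj | ∃ i, X = S i}} (p : CSeq (fun X Y : {X : PObj | ∃ i, X = S i} =>
      ⨁ n, HomCohomology k (cpx k X.1) (cpx k Y.1) n) X Y) :
    c.branchSum n (p.map Subtype.val (fun f => f)) ∈ LinearMap.range (c.iTot X.1 Y.1) := by
  rw [Contraction.branchSum, cutSum_map]
  refine cutSum_mem _ _ p fun e _ => ?_
  obtain ⟨x, hx⟩ := hn e.2.1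
  obtain ⟨y, hy⟩ := hn e.2.2
  obtain ⟨⟨Z, l, rfl⟩, p', q'⟩ := e
  obtain ⟨X, j, rfl⟩ := X
  obtain ⟨Y, i, rfl⟩ := Y
  simp only at hx hy ⊢
  rw [← hx, ← hy]
  exact signedComp_mem_range_iTot c y x

/-- The sums over trees on sequences of morphisms between simple modules. -/
lemma edgeSum_simples (n : ℕ) : ∀ {X Y : {X : PObj | ∃ i, X = S i}}
    (p : CSeq (fun X Y : {X : PObj | ∃ i, X = S i} =>
      ⨁ n, HomCohomology k (cpx k X.1) (cpx k Y.1) n) X Y),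
    c.edgeSum n (p.map Subtype.val (fun f => f)) ∈ LinearMap.range (c.iTot X.1 Y.1) ∧
    (2 ≤ p.length → c.edgeSum n (p.map Subtype.val (fun f => f)) = 0) := by
  induction n with
  | zero => exact fun p => ⟨zero_mem _, fun _ => rfl⟩
  | succ n ih =>
    intro X Y p
    obtain ⟨x, hx⟩ := branchSum_mem_range_iTot c n (fun q => (ih q).1) p
    -- The branch sum lies in the image of i, where the homotopy vanishes. Only leaves survive.
    rw [Contraction.edgeSum_succ, ← hx, Contraction.hTot_iTot, add_zero]
    refine ⟨?_, fun hp => c.leafSum_of_two_le _ (by rwa [length_map])⟩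
    rcases p with _ | ⟨f, _ | ⟨g, p⟩⟩
    · exact zero_mem _
    · exact ⟨f, rfl⟩
    · exact zero_mem _

/-- Cutting three or more entries leaves a piece with at least two, whose edge sum is zero. -/
lemma rootSum_simples {X Y : {X : PObj | ∃ i, X = S i}}
    (p : CSeq (fun X Y : {X : PObj | ∃ i, X = S i} =>
      ⨁ n, HomCohomology k (cpx k X.1) (cpx k Y.1) n) X Y) (hp : 2 < p.length) :
    c.rootSum (p.map Subtype.val (fun f => f)) = 0 := by
  rw [Contraction.rootSum, Contraction.branchSum, cutSum_map]
  refine (congrArg _ ((cutSum_congr p fun Z a b hab => ?_).trans (cutSum_zero p))).trans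
    (map_zero _)
  rcases Nat.lt_or_ge a.length 2 with ha | ha
  · rw [(edgeSum_simples c _ b).2 (by omega), map_zero, LinearMap.zero_apply]
  · rw [(edgeSum_simples c _ a).2 ha, map_zero]

/-- Both classes have forced representatives, so their product is the class of the exact composite.
The minus sign is (-1)^|f| for the degree one factor. -/
lemma rootSum_extClass (hn : j + 1 = i + n) (w : Cochain (cpx k (S (j + 1))) (cpx k (S i)) n)
    (hw : δ n (n + 1) w = 0) (z : Cochain (cpx k (S j)) (cpx k (S i)) (1 + n))
    (hz : δ (1 + n) (1 + n + 1) z = 0) (h : (extCochain k j (j + 1)).comp w rfl = z) :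
    c.rootSum (pair
      (lof k ℤ (HomCohomology k (cpx k (S (j + 1))) (cpx k (S i))) n (cohClass k w hw))
      (lof k ℤ (HomCohomology k (cpx k (S j)) (cpx k (S (j + 1)))) 1 (extClass k j (j + 1)))) =
      -lof k ℤ (HomCohomology k (cpx k (S j)) (cpx k (S i))) (1 + n) (cohClass k z hz) := by
  have h1 : j = j + 1 + ((1 : ℤ) : ZMod 2) := by
    push_cast
    exact (PiA2.zmod_two_add_one j).symm
  rw [Contraction.rootSum_pair, Contraction.iTot_lof, Contraction.iTot_lof,
    c.i_cohClass (fun y => δ_eq_zero hn (sub_add_cancel _ 1) y), extClass,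
    c.i_cohClass (fun y => δ_eq_zero h1 (sub_add_cancel _ 1) y), signedComp_lof rfl, h, map_zsmul,
    Contraction.pTot_lof, c.p_cocycle z hz]
  simp

/-- Induction on the degree, splitting off one degree one class at a time. Negative degrees have no
cohomology and degree 0 consists of scalars. -/
lemma isGeneratedBy_alpha_beta :
    (simples c).IsGeneratedBy {⟨_, _, alpha c⟩, ⟨_, _, beta c⟩} := by
  intro W hone hgen hmul
  -- The vertices enter through equations so that α and β together become the statement for j and j
  -- + 1 at an arbitrary vertex j.
  have hα : ∀ j i : ZMod 2, j = 2 → i = 1 →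
      lof k ℤ ((simples c).Hom (simple c j) (simple c i)) 1 (extClass k j i) ∈
        W (simple c j) (simple c i) := by
    rintro _ _ rfl rfl
    exact hgen ⟨_, _, alpha c⟩ (Or.inl rfl)
  have hβ : ∀ j i : ZMod 2, j = 1 → i = 2 →
      lof k ℤ ((simples c).Hom (simple c j) (simple c i)) 1 (extClass k j i) ∈
        W (simple c j) (simple c i) := by
    rintro _ _ rfl rfl
    exact hgen ⟨_, _, beta c⟩ (Or.inr rfl)
  have hext : ∀ j : ZMod 2,
      lof k ℤ ((simples c).Hom (simple c j) (simple c (j + 1))) 1 (extClass k j (j + 1)) ∈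
        W (simple c j) (simple c (j + 1)) := by
    intro j
    have hj : (j = 2 ∧ j + 1 = 1) ∨ (j = 1 ∧ j + 1 = 2) := by revert j; decide
    rcases hj with ⟨h1, h2⟩ | ⟨h1, h2⟩
    · exact hα _ _ h1 h2
    · exact hβ _ _ h1 h2
  have hnat : ∀ n : ℕ, ∀ (j i : ZMod 2) (m : ℤ), m = n →
      ∀ x : HomCohomology k (cpx k (S j)) (cpx k (S i)) m,
      lof k ℤ ((simples c).Hom (simple c j) (simple c i)) m x ∈ W (simple c j) (simple c i) := by
    intro n
    induction n with
    | zero =>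
      intro j i m hm x
      obtain rfl : m = 0 := by simpa using hm
      by_cases hji : j = i + ((0 : ℤ) : ZMod 2)
      · obtain rfl : j = i := by simpa using hji
        obtain ⟨a, ha⟩ := eq_smul_id_of_cocycle (c.i (S j) (S j) 0 x).1 (c.i (S j) (S j) 0 x).2
        have hx : x = a • cohClass k (Cochain.ofHom (𝟙 (cpx k (S j)))) (by simp) := by
          rw [← c.class_i (S j) (S j) 0 x, cohClass, ← Submodule.Quotient.mk_smul]
          exact congrArg _ (Subtype.ext ha)
        rw [hx]
        refine Eq.mp (congrArg (· ∈ W (simple c j) (simple c j)) (LinearMap.map_smul _ a _).symm) ?_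
        exact Submodule.smul_mem _ a (hone (simple c j))
      · rw [homCohomology_eq_zero hji x]
        exact Eq.mp (congrArg (· ∈ W (simple c j) (simple c i)) (map_zero _).symm) (zero_mem _)
    | succ n ih =>
      intro j i m hm x
      obtain rfl : m = 1 + (n : ℤ) := by rw [hm]; push_cast; ring
      by_cases hji : j = i + ((1 + (n : ℤ) : ℤ) : ZMod 2)
      · have hji' : j + 1 = i + ((n : ℤ) : ZMod 2) := by
          rw [hji]
          push_cast
          linear_combination PiA2.zmod_two_add_one i
        obtain ⟨w, hw, hwz⟩ := exists_comp_extCochain (Int.natCast_nonneg n)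
          (c.i (S j) (S i) _ x).1 (c.i (S j) (S i) _ x).2
        have h1 := hmul _ _ (ih (j + 1) i n rfl (cohClass k w hw)) (hext j)
        have h2 := (Contraction.transfer_m _).trans
          (rootSum_extClass c hji' w hw _ (c.i (S j) (S i) _ x).2 hwz)
        rw [c.cohClass_i] at h2
        have h3 := neg_mem (Eq.mp (congrArg (· ∈ W (simple c j) (simple c i)) h2) h1)
        exact Eq.mp (congrArg (· ∈ W (simple c j) (simple c i)) (neg_neg _)) h3
      · rw [homCohomology_eq_zero hji x]
        exact Eq.mp (congrArg (· ∈ W (simple c j) (simple c i)) (map_zero _).symm) (zero_mem _)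
  have hneg : ∀ (j i : ZMod 2) (m : ℤ), m < 0 →
      ∀ x : HomCohomology k (cpx k (S j)) (cpx k (S i)) m,
      lof k ℤ ((simples c).Hom (simple c j) (simple c i)) m x ∈ W (simple c j) (simple c i) := by
    intro j i m hm x
    have hx : x = 0 := by
      by_cases hji : j = i + m
      · have h1 := eq_zero_of_cocycle hji hm.le (c.i (S j) (S i) m x).1 (c.i (S j) (S i) m x).2
          (fun h => absurd h hm.ne)
        rw [← c.p_i (S j) (S i) m x, h1, map_zero]
      · exact homCohomology_eq_zero hji x
    rw [hx]
    exact Eq.mp (congrArg (· ∈ W (simple c j) (simple c i)) (map_zero _).symm) (zero_mem _)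
  rintro ⟨X, j, rfl⟩ ⟨Y, i, rfl⟩
  refine eq_top_iff.2 fun f _ => ?_
  induction f using DirectSum.induction_on with
  | zero => exact zero_mem _
  | add f g hf hg => exact add_mem (hf trivial) (hg trivial)
  | of m x =>
    rcases lt_or_ge m 0 with hm | hm
    · exact hneg j i m hm x
    · exact hnat m.toNat j i m (by omega) x

end Simples

end

/-! ### The main theorem -/

theorem mainTheorem4 (k : Type u) [Field k] :
    Nonempty (Contraction k (PObj.cpx k)) ∧
    ∀ c : Contraction k (PObj.cpx k),
      (preproj c).IsAInfCategory ∧ (simples c).IsAInfCategory ∧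
      -- the subcategory of simples is generated by `α` and `β`
      (simples c).IsGeneratedBy {⟨_, _, alpha c⟩, ⟨_, _, beta c⟩} ∧
      -- formality
      (∀ (X Y : (simples c).Obj) (f : (simples c).Tot X Y),
        (simples c).m (CSeq.single f) = 0) ∧
      (∀ (X Y : (simples c).Obj) (p : CSeq (simples c).Tot X Y),
        2 < p.length → (simples c).m p = 0) ∧
      -- the inclusion is a strict functor
      AInfData.IsAInfFunctor (simples c) (preproj c) Subtype.val (incl c) ∧
      (∀ (X Y : (simples c).Obj) (f : (simples c).Tot X Y), incl c (CSeq.single f) = f) ∧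
      (∀ (X Y : (simples c).Obj) (p : CSeq (simples c).Tot X Y),
        2 ≤ p.length → incl c p = 0) ∧
      -- it is determined by its values on `α` and `β` and the vanishing of its higher components
      (∀ G : ∀ {X Y : (simples c).Obj},
          CSeq (simples c).Tot X Y → (preproj c).Tot X.1 Y.1,
        AInfData.IsAInfFunctor (simples c) (preproj c) Subtype.val G →
        G (CSeq.single (alpha c)) = alpha c → G (CSeq.single (beta c)) = beta c →
        (∀ (X Y : (simples c).Obj) (p : CSeq (simples c).Tot X Y), 2 ≤ p.length → G p = 0) →
        ∀ (X Y : (simples c).Obj) (p : CSeq (simples c).Tot X Y), G p = incl c p) := by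
  refine ⟨Contraction.nonempty _, fun c => ?_⟩
  have hC : (preproj c).IsAInfCategory := (isUnital_cpx c).isAInfCategory
  have h1 : ∀ {X Y : (preproj c).Obj} (f : (preproj c).Tot X Y),
      (preproj c).m (CSeq.single f) = 0 := fun f =>
    (Contraction.transfer_m _).trans (Contraction.rootSum_single f)
  refine ⟨hC, hC.full _, isGeneratedBy_alpha_beta c, fun X Y f => h1 f, fun X Y p hp => ?_,
    hC.isAInfFunctor_fullIncl _, fun X Y f => rfl,
    fun X Y p hp => AInfData.fullIncl_of_two_le _ p hp, ?_⟩
  · exact (Contraction.transfer_m _).trans (rootSum_simples c p hp)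
  intro G hG hα hβ hG2 X Y p
  -- The morphisms fixed by `G`. They contain the identities, α and β and are closed under m_2, so
  -- generation gives all morphisms.
  let W : ∀ X Y : (simples c).Obj, Submodule k ((simples c).Tot X Y) := fun X Y =>
    { carrier := {f | G (CSeq.single f) = f}
      add_mem' := fun {f g} hf hg =>
        (hG.multilinear.map_add (CSeq.nil X) f g (CSeq.nil Y)).trans (congrArg₂ (· + ·) hf hg)
      zero_mem' := hG.multilinear.map_zero_entry (CSeq.nil X) (CSeq.nil Y)
      smul_mem' := fun a f hf =>
        (hG.multilinear.map_smul (CSeq.nil X) a f (CSeq.nil Y)).trans (congrArg (a • ·) hf) }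
  have hW : ∀ X Y, W X Y = ⊤ := by
    refine isGeneratedBy_alpha_beta c W (fun X => hG.map_unit X) ?_ ?_
    · rintro f (rfl | rfl)
      · exact hα
      · exact hβ
    · intro X Y Z g f hg hf
      exact (hG.map_m_pair (fun p hp => hG2 _ _ p hp) h1 g f).trans
        (congrArg₂ (fun a b => (preproj c).m (CSeq.pair a b)) hg hf)
  rcases p with _ | ⟨f, _ | ⟨g, p⟩⟩
  · exact hG.nil _
  · have : f ∈ W _ _ := hW _ _ ▸ Submodule.mem_top
    exact this
  · exact hG2 _ _ _ (by simp only [CSeq.length]; omega)
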